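/- Let $L$ be the first-order language with equality whose only relation symbol is the binary symbol $\in$ and whose function symbols are the constants $\varnothing$ and $\omega$, the unary symbols $\mathcal P$ (power set) and $\bigcup$ (union), and the binary symbol $(\cdot,\cdot)$ (ordered pair). Provability, $T\vdash\varphi$, means derivability of $\varphi$ from the set of sentences $T$ in natural deduction for classical first-order logic with equality. Abbreviate $x\subseteq y:\Leftrightarrow\forall z\in x\,(z\in y)$, and let $\mathrm{Ord}(z)$ be the conjunction of: $\forall x,y\in z\,(x=y\vee x\in y\vee y\in x)$; $\forall x\,(x\subseteq z\to x\neq\varnothing\to\exists y\in x\,\forall w\in x\;w\notin y)$; $\forall x\,(x\in z\to x\subseteq z)$. Let $\mathsf{ZFC}$ be the $L$-theory with the following axioms: - Empty set: $\forall x\;x\notin\varnothing$. - Ordered pairs: $\forall x,y,z,w\,\big((x,y)=(z,w)\leftrightarrow x=z\wedge y=w\big)$. - Extensionality: $\forall x,y\,\big(\forall z(z\in x\leftrightarrow z\in y)\to x=y\big)$. - Union: $\forall u,x\,\big(x\in\bigcup u\leftrightarrow\exists y\in u\;x\in y\big)$. - Power set: $\forall z,y\,\big(y\in\mathcal P(z)\leftrightarrow\forall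 x\in y\;x\in z\big)$. - Infinity: $\varnothing\in\omega\wedge(\forall x\in\omega\,\exists y\in\omega\;x\in y)\wedge\exists\alpha(\mathrm{Ord}(\alpha)\wedge\omega=\alpha)\wedge\forall\alpha\,\big(\mathrm{Ord}(\alpha)\to(\varnothing\in\alpha\wedge\forall x\in\alpha\,\exists y\in\alpha\;x\in y)\to\omega\subseteq\alpha\big)$. - Regularity: $\forall x\,(x\neq\varnothing\to\exists y\in x\,\forall z\in x\;z\notin y)$. - Zorn's lemma: $\forall z\,\Big(z\neq\varnothing\to\forall y\big((y\subseteq z\wedge\forall x_1,x_2\in y\,(x_1\subseteq x_2\vee x_2\subseteq x_1))\to\bigcup y\in z\big)\to\exists m\in z\,\forall x\in z\,(m\subseteq x\to m=x)\Big)$. - Collection, for every $n\in\mathbb N$ and every $L$-formula $\phi(x,y,p)$ with free variables among $x,y,p=(p_1,\dots,p_n)$: $\forall p\,\forall A\,\Big((\forall x\in A\,\exists y\,\phi(x,y,p))\to\exists B\big((\forall x\in A\,\exists y\in B\,\phi(x,y,p))\wedge\forall y\in B\,\exists x\in A\,\phi(x,y,p)\big)\Big)$. Let $\mathsf{CH}$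 be the $L$-sentence $\forall x\,\big(\mathrm{Ord}(x)\to x\le\omega\,\vee\,\mathcal P(\omega)\le x\big)$, where $x\le y$ is the formula stating that there are a set $S\subseteq y$ and a surjective function $f:S\to x$ (a set of ordered pairs). Then $\mathsf{CH}$ is independent of $\mathsf{ZFC}$: $\mathsf{ZFC}\nvdash\mathsf{CH}$ and $\mathsf{ZFC}\nvdash\neg\mathsf{CH}$. -/

import Mathlib

namespace FOL

universe u v

/-- Partially applied terms with de Bruijn variables; a `Preterm L n` becomes a term after being
applied to `n` terms. -/
inductive Preterm (L : FirstOrder.Language.{u, v}) : ℕ → Type u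
  | var : ℕ → Preterm L 0
  | func {l : ℕ} : L.Functions l → Preterm L l
  | app {l : ℕ} : Preterm L (l + 1) → Preterm L 0 → Preterm L l

/-- Terms. -/
abbrev Term (L : FirstOrder.Language.{u, v}) := Preterm L 0

/-- Partially applied formulas; a `Preformula L n` becomes a formula after being applied to
`n` terms. -/
inductive Preformula (L : FirstOrder.Language.{u, v}) : ℕ → Type (max u v)
  | falsum : Preformula L 0
  | equal : Term L → Term L → Preformula L 0
  | rel {l : ℕ} : L.Relations l → Preformula L l
  | apprel {l : ℕ} : Preformula L (l + 1) → Term L → Preformula L l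
  | imp : Preformula L 0 → Preformula L 0 → Preformula L 0
  | all : Preformula L 0 → Preformula L 0

/-- Formulas. -/
abbrev Formula (L : FirstOrder.Language.{u, v}) := Preformula L 0

prefix:max "&" => Preterm.var
infix:70 " ≐ " => Preformula.equal
infixr:40 " ⟹ " => Preformula.imp

variable {L : FirstOrder.Language.{u, v}}

namespace Preterm

/-- `t.lift n m`: all variables of `t` which are at least `m` are increased by `n`. -/
def lift : {l : ℕ} → Preterm L l → ℕ → ℕ → Preterm L l
  | _, var k, n, m => var (if m ≤ k then k + n else k)
  | _, func f, _, _ => func f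
  | _, app s t, n, m => app (s.lift n m) (t.lift n m)

/-- `t.subst s n`: the variable `n` is replaced by `s` (lifted by `n`), and larger variables are
decreased by one. -/
def subst : {l : ℕ} → Preterm L l → Term L → ℕ → Preterm L l
  | _, var k, s, n => if k < n then var k else if k = n then s.lift n 0 else var (k - 1)
  | _, func f, _, _ => func f
  | _, app t₁ t₂, s, n => app (t₁.subst s n) (t₂.subst s n)

/-- All variables are less than `b`. -/
def BoundedBy : {l : ℕ} → Preterm L l → ℕ → Prop
  | _, var k, b => k < b
  | _, func _, _ => True
  | _, app s t, b => s.BoundedBy b ∧ t.BoundedBy b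

end Preterm

namespace Preformula

/-- `f.lift n m`: all free variables of `f` which are at least `m` are increased by `n`. -/
def lift : {l : ℕ} → Preformula L l → ℕ → ℕ → Preformula L l
  | _, falsum, _, _ => falsum
  | _, equal s t, n, m => equal (s.lift n m) (t.lift n m)
  | _, rel R, _, _ => rel R
  | _, apprel f t, n, m => apprel (f.lift n m) (t.lift n m)
  | _, imp f g, n, m => imp (f.lift n m) (g.lift n m)
  | _, all f, n, m => all (f.lift n (m + 1))

/-- `f.subst s n`: the `n`-th free variable is replaced by `s` (lifted by `n`, and by one more for
every quantifier passed), and larger free variables are decreased by one. -/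
def subst : {l : ℕ} → Preformula L l → Term L → ℕ → Preformula L l
  | _, falsum, _, _ => falsum
  | _, equal t₁ t₂, s, n => equal (t₁.subst s n) (t₂.subst s n)
  | _, rel R, _, _ => rel R
  | _, apprel f t, s, n => apprel (f.subst s n) (t.subst s n)
  | _, imp f g, s, n => imp (f.subst s n) (g.subst s n)
  | _, all f, s, n => all (f.subst s (n + 1))

/-- All free variables are less than `b`. -/
def BoundedBy : {l : ℕ} → Preformula L l → ℕ → Prop
  | _, falsum, _ => True
  | _, equal s t, b => s.BoundedBy b ∧ t.BoundedBy b
  | _, rel _, _ => True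
  | _, apprel f t, b => f.BoundedBy b ∧ t.BoundedBy b
  | _, imp f g, b => f.BoundedBy b ∧ g.BoundedBy b
  | _, all f, b => f.BoundedBy (b + 1)

end Preformula

/-- Negation. -/
def neg (f : Formula L) : Formula L := f ⟹ Preformula.falsum

/-- Disjunction. -/
def disj (f g : Formula L) : Formula L := neg f ⟹ g

/-- Conjunction. -/
def conj (f g : Formula L) : Formula L := neg (f ⟹ neg g)

infixr:50 " ⋎ " => disj
infixr:60 " ⋏ " => conj

/-- Biconditional. -/
def bicond (f g : Formula L) : Formula L := (f ⟹ g) ⋏ (g ⟹ f)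

infix:45 " ⟺ " => bicond

/-- Universal quantification (binds variable `0`). -/
abbrev all (f : Formula L) : Formula L := Preformula.all f

/-- Existential quantification (binds variable `0`). -/
def ex (f : Formula L) : Formula L := neg (all (neg f))

/-- Universal quantification over the first `n` variables. -/
def alls : ℕ → Formula L → Formula L
  | 0, f => f
  | n + 1, f => alls n (all f)

/-- Proof trees of natural deduction for classical first-order logic with equality. -/
inductive Prf : Set (Formula L) → Formula L → Type (max u v)
  | axm (Γ : Set (Formula L)) (A : Formula L) : A ∈ Γ → Prf Γ A
  | impI (Γ : Set (Formula L)) (A B : Formula L) : Prf (insert A Γ) B → Prf Γ (A ⟹ B)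
  | impE (Γ : Set (Formula L)) (A B : Formula L) : Prf Γ (A ⟹ B) → Prf Γ A → Prf Γ B
  | falsumE (Γ : Set (Formula L)) (A : Formula L) :
      Prf (insert (neg A) Γ) Preformula.falsum → Prf Γ A
  | allI (Γ : Set (Formula L)) (A : Formula L) :
      Prf ((fun f : Formula L => f.lift 1 0) '' Γ) A → Prf Γ (all A)
  | allE₂ (Γ : Set (Formula L)) (A : Formula L) (t : Term L) :
      Prf Γ (all A) → Prf Γ (A.subst t 0)
  | ref (Γ : Set (Formula L)) (t : Term L) : Prf Γ (t ≐ t)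
  | subst₂ (Γ : Set (Formula L)) (s t : Term L) (f : Formula L) :
      Prf Γ (s ≐ t) → Prf Γ (f.subst s 0) → Prf Γ (f.subst t 0)

/-- A formula is provable from `Γ` if a proof tree exists. -/
def Provable (Γ : Set (Formula L)) (f : Formula L) : Prop := Nonempty (Prf Γ f)

/-- Sentences: formulas without free variables. -/
abbrev Sentence (L : FirstOrder.Language.{u, v}) := {f : Formula L // f.BoundedBy 0}

/-- Theories: sets of sentences. -/
abbrev Theory (L : FirstOrder.Language.{u, v}) := Set (Sentence L)

/-- Negation of a sentence. -/
def Sentence.not (f : Sentence L) : Sentence L := ⟨neg f.1, f.2, trivial⟩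

/-- Provability of a sentence from a theory. -/
def Theory.Proves (T : Theory L) (f : Sentence L) : Prop :=
  Provable (Subtype.val '' T) f.1

/-- `f` is neither provable nor refutable from `T`. -/
def Independent (T : Theory L) (f : Sentence L) : Prop :=
  ¬ Theory.Proves T f ∧ ¬ Theory.Proves T (Sentence.not f)

theorem Preterm.BoundedBy.lift {l : ℕ} {t : Preterm L l} {b : ℕ} (h : t.BoundedBy b) (n m : ℕ) :
    (t.lift n m).BoundedBy (b + n) := by
  induction t with
  | var k => simp only [Preterm.lift, Preterm.BoundedBy] at *; split_ifs <;> omega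
  | func f => trivial
  | app s t ihs iht => exact ⟨ihs h.1, iht h.2⟩

theorem Preterm.BoundedBy.subst {l : ℕ} {t : Preterm L l} {b n : ℕ} (h : t.BoundedBy (b + n + 1))
    {s : Term L} (hs : s.BoundedBy b) : (t.subst s n).BoundedBy (b + n) := by
  induction t with
  | var k =>
    simp only [Preterm.subst]
    simp only [Preterm.BoundedBy] at h
    split_ifs with h1 h2
    · simp only [Preterm.BoundedBy]; omega
    · exact hs.lift n 0
    · simp only [Preterm.BoundedBy]; omega
  | func f => trivial
  | app s t ihs iht => exact ⟨ihs h.1, iht h.2⟩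

theorem Preformula.BoundedBy.lift {l : ℕ} {f : Preformula L l} {b : ℕ} (h : f.BoundedBy b)
    (n m : ℕ) : (f.lift n m).BoundedBy (b + n) := by
  induction f generalizing b m with
  | falsum => trivial
  | equal s t => exact ⟨Preterm.BoundedBy.lift h.1 n m, Preterm.BoundedBy.lift h.2 n m⟩
  | rel R => trivial
  | apprel f t ih => exact ⟨ih h.1 m, Preterm.BoundedBy.lift h.2 n m⟩
  | imp f g ihf ihg => exact ⟨ihf h.1 m, ihg h.2 m⟩
  | all f ih =>
    have := ih (b := b + 1) h (m + 1)
    rw [show b + 1 + n = b + n + 1 by omega] at this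
    exact this

theorem Preformula.BoundedBy.subst {l : ℕ} {f : Preformula L l} {b n : ℕ}
    (h : f.BoundedBy (b + n + 1)) {s : Term L} (hs : s.BoundedBy b) :
    (f.subst s n).BoundedBy (b + n) := by
  induction f generalizing n with
  | falsum => trivial
  | equal s t => exact ⟨Preterm.BoundedBy.subst h.1 hs, Preterm.BoundedBy.subst h.2 hs⟩
  | rel R => trivial
  | apprel f t ih => exact ⟨ih h.1, Preterm.BoundedBy.subst h.2 hs⟩
  | imp f g ihf ihg => exact ⟨ihf h.1, ihg h.2⟩
  | all f ih => exact ih (n := n + 1) h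

instance Preterm.decidableBoundedBy : {l : ℕ} → (t : Preterm L l) → (b : ℕ) →
    Decidable (t.BoundedBy b)
  | _, .var k, b => inferInstanceAs (Decidable (k < b))
  | _, .func _, _ => inferInstanceAs (Decidable True)
  | _, .app s t, b =>
    have := s.decidableBoundedBy b
    have := t.decidableBoundedBy b
    inferInstanceAs (Decidable (s.BoundedBy b ∧ t.BoundedBy b))

instance Preformula.decidableBoundedBy : {l : ℕ} → (f : Preformula L l) → (b : ℕ) →
    Decidable (f.BoundedBy b)
  | _, .falsum, _ => inferInstanceAs (Decidable True)
  | _, .equal s t, b => inferInstanceAs (Decidable (s.BoundedBy b ∧ t.BoundedBy b))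
  | _, .rel _, _ => inferInstanceAs (Decidable True)
  | _, .apprel f t, b =>
    have := f.decidableBoundedBy b
    inferInstanceAs (Decidable (f.BoundedBy b ∧ t.BoundedBy b))
  | _, .imp f g, b =>
    have := f.decidableBoundedBy b
    have := g.decidableBoundedBy b
    inferInstanceAs (Decidable (f.BoundedBy b ∧ g.BoundedBy b))
  | _, .all f, b => f.decidableBoundedBy (b + 1)

theorem boundedBy_alls {f : Formula L} {n : ℕ} (h : f.BoundedBy n) : (alls n f).BoundedBy 0 := by
  induction n generalizing f with
  | zero => exact h
  | succ n ih => exact ih (f := all f) h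

end FOL

namespace SetTheory

open FOL

/-- Function symbols: empty set, ordered pair, the natural numbers, power set, union. -/
inductive ZFCFunc : ℕ → Type
  | emptyset : ZFCFunc 0
  | pr : ZFCFunc 2
  | omega : ZFCFunc 0
  | powerset : ZFCFunc 1
  | union : ZFCFunc 1

/-- The only relation symbol is membership. -/
inductive ZFCRel : ℕ → Type
  | mem : ZFCRel 2

/-- The language of set theory with the above function symbols. -/
def LZFC : FirstOrder.Language.{0, 0} := ⟨ZFCFunc, ZFCRel⟩

/-- The term `∅`. -/
def emptyT : Term LZFC := Preterm.func (L := LZFC) ZFCFunc.emptyset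

/-- The term `ω`. -/
def omegaT : Term LZFC := Preterm.func (L := LZFC) ZFCFunc.omega

/-- The term `(s, t)`. -/
def pairT (s t : Term LZFC) : Term LZFC :=
  Preterm.app (Preterm.app (Preterm.func (L := LZFC) ZFCFunc.pr) s) t

/-- The term `𝒫(t)`. -/
def powersetT (t : Term LZFC) : Term LZFC :=
  Preterm.app (Preterm.func (L := LZFC) ZFCFunc.powerset) t

/-- The term `⋃ t`. -/
def unionT (t : Term LZFC) : Term LZFC :=
  Preterm.app (Preterm.func (L := LZFC) ZFCFunc.union) t

/-- The formula `s ∈ t`. -/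
def memF (s t : Term LZFC) : Formula LZFC :=
  Preformula.apprel (Preformula.apprel (Preformula.rel (L := LZFC) ZFCRel.mem) s) t

infix:70 " ∊ " => memF

/-- Lifting all variables of a term by `n`, to use it under `n` further quantifiers. -/
def up (t : Term LZFC) (n : ℕ) : Term LZFC := t.lift n 0

/-- `∀ x ∈ t, f`, where `x` is the variable `0` of `f`. -/
def allIn (t : Term LZFC) (f : Formula LZFC) : Formula LZFC := all (&0 ∊ up t 1 ⟹ f)

/-- `∃ x ∈ t, f`, where `x` is the variable `0` of `f`. -/
def exIn (t : Term LZFC) (f : Formula LZFC) : Formula LZFC := ex (&0 ∊ up t 1 ⋏ f)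

/-- `s ⊆ t`. -/
def subsetF (s t : Term LZFC) : Formula LZFC := allIn s (&0 ∊ up t 1)

/-- `∀ x y ∈ z, x = y ∨ x ∈ y ∨ y ∈ x`. -/
def epsilonTrichotomy (z : Term LZFC) : Formula LZFC :=
  allIn z (allIn (up z 1) (&1 ≐ &0 ⋎ &1 ∊ &0 ⋎ &0 ∊ &1))

/-- `∀ x, x ⊆ z → x ≠ ∅ → ∃ y ∈ x, ∀ w ∈ x, w ∉ y`. -/
def epsilonWellfounded (z : Term LZFC) : Formula LZFC :=
  all (subsetF &0 (up z 1) ⟹ neg (&0 ≐ emptyT) ⟹ exIn &0 (allIn &1 (neg (&0 ∊ &1))))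

/-- `∀ x, x ∈ z → x ⊆ z`. -/
def epsilonTransitive (z : Term LZFC) : Formula LZFC :=
  allIn z (subsetF &0 (up z 1))

/-- `z` is an ordinal. -/
def isOrdinal (z : Term LZFC) : Formula LZFC :=
  epsilonTrichotomy z ⋏ epsilonWellfounded z ⋏ epsilonTransitive z

/-- `f` is a function from `s` to `x`: `f ⊆ s × x`, every element of `s` has a value in `x`, and
values are unique. -/
def isFunction (s x f : Term LZFC) : Formula LZFC :=
  allIn f (exIn (up s 1) (exIn (up x 2) (&2 ≐ pairT &1 &0))) ⋏
  allIn s (exIn (up x 1) (pairT &1 &0 ∊ up f 2)) ⋏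
  all (all (all (pairT &2 &1 ∊ up f 3 ⟹ pairT &2 &0 ∊ up f 3 ⟹ &1 ≐ &0)))

/-- `f` is a surjective function from `s` to `x`. -/
def isSurjection (s x f : Term LZFC) : Formula LZFC :=
  isFunction s x f ⋏ allIn x (exIn (up s 1) (pairT &0 &1 ∊ up f 2))

/-- `x ≤ y`: there is a surjection from a subset of `y` to `x`. -/
def leqF (x y : Term LZFC) : Formula LZFC :=
  ex (subsetF &0 (up y 1) ⋏ ex (isSurjection &1 (up x 2) &0))

/-- `∀ x, x ∉ ∅`. -/
def axiomOfEmptyset : Sentence LZFC :=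
  ⟨all (neg (&0 ∊ emptyT)), by decide⟩

/-- `∀ x y z w, (x, y) = (z, w) ↔ x = z ∧ y = w`. -/
def axiomOfOrderedPairs : Sentence LZFC :=
  ⟨all (all (all (all (pairT &3 &2 ≐ pairT &1 &0 ⟺ &3 ≐ &1 ⋏ &2 ≐ &0)))), by decide⟩

/-- `∀ x y, (∀ z, z ∈ x ↔ z ∈ y) → x = y`. -/
def axiomOfExtensionality : Sentence LZFC :=
  ⟨all (all (all (&0 ∊ &2 ⟺ &0 ∊ &1) ⟹ &1 ≐ &0)), by decide⟩

/-- `∀ u x, x ∈ ⋃ u ↔ ∃ y ∈ u, x ∈ y`. -/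
def axiomOfUnion : Sentence LZFC :=
  ⟨all (all (&0 ∊ unionT &1 ⟺ exIn &1 (&1 ∊ &0))), by decide⟩

/-- `∀ z y, y ∈ 𝒫(z) ↔ ∀ x ∈ y, x ∈ z`. -/
def axiomOfPowerset : Sentence LZFC :=
  ⟨all (all (&0 ∊ powersetT &1 ⟺ allIn &0 (&0 ∊ &2))), by decide⟩

/-- `∅ ∈ ω ∧ (∀ x ∈ ω, ∃ y ∈ ω, x ∈ y) ∧ (∃ α, Ord(α) ∧ ω = α) ∧
∀ α, Ord(α) → (∅ ∈ α ∧ ∀ x ∈ α, ∃ y ∈ α, x ∈ y) → ω ⊆ α`. -/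
def axiomOfInfinity : Sentence LZFC :=
  ⟨emptyT ∊ omegaT ⋏
    allIn omegaT (exIn omegaT (&1 ∊ &0)) ⋏
    ex (isOrdinal &0 ⋏ omegaT ≐ &0) ⋏
    all (isOrdinal &0 ⟹ (emptyT ∊ &0 ⋏ allIn &0 (exIn &1 (&1 ∊ &0))) ⟹ subsetF omegaT &0), by decide⟩

/-- `∀ x, x ≠ ∅ → ∃ y ∈ x, ∀ z ∈ x, z ∉ y`. -/
def axiomOfRegularity : Sentence LZFC :=
  ⟨all (neg (&0 ≐ emptyT) ⟹ exIn &0 (allIn &1 (neg (&0 ∊ &1)))), by decide⟩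

/-- `∀ z, z ≠ ∅ → (∀ y, (y ⊆ z ∧ ∀ x₁ x₂ ∈ y, x₁ ⊆ x₂ ∨ x₂ ⊆ x₁) → ⋃ y ∈ z) →
∃ m ∈ z, ∀ x ∈ z, m ⊆ x → m = x`. -/
def zornsLemma : Sentence LZFC :=
  ⟨all (neg (&0 ≐ emptyT) ⟹
    all ((subsetF &0 &1 ⋏ allIn &0 (allIn &1 (subsetF &1 &0 ⋎ subsetF &0 &1))) ⟹
      unionT &0 ∊ &1) ⟹
    exIn &0 (allIn &1 (subsetF &1 &0 ⟹ &1 ≐ &0))), by decide⟩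

/-- `∀ p A, (∀ x ∈ A, ∃ y, φ(x, y, p)) →
∃ B, (∀ x ∈ A, ∃ y ∈ B, φ(x, y, p)) ∧ ∀ y ∈ B, ∃ x ∈ A, φ(x, y, p)`,
for a formula `φ` whose free variables are `y` (variable `0`), `x` (variable `1`) and the `n`
parameters `p` (variables `2, …, n + 1`). The lifts make room for `A`, respectively for `A` and `B`,
between `x` and `p`; the substitution at the end exchanges the roles of the variables `0` and `1`. -/
def axiomOfCollection (n : ℕ) (φ : Formula LZFC) (hφ : φ.BoundedBy (n + 2)) : Sentence LZFC :=
  ⟨alls n (all (allIn &0 (ex (φ.lift 1 2)) ⟹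
    ex (allIn &1 (exIn &1 (φ.lift 2 2)) ⋏
      allIn &0 (exIn &2 ((φ.lift 3 2).subst &1 0))))), by
    have h1 : (φ.lift 1 2).BoundedBy (n + 3) := hφ.lift 1 2
    have h2 : (φ.lift 2 2).BoundedBy (n + 4) := hφ.lift 2 2
    have h3 : ((φ.lift 3 2).subst &1 0).BoundedBy (n + 4) :=
      Preformula.BoundedBy.subst (b := n + 4) (n := 0) (hφ.lift 3 2)
        (by simp [Preterm.BoundedBy])
    apply boundedBy_alls
    simp [neg, conj, ex, allIn, exIn, up, memF, Preterm.lift, Preterm.BoundedBy,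
      Preformula.BoundedBy, h1, h2, h3]⟩

/-- Zermelo-Fraenkel set theory with choice. -/
def ZFC : Theory LZFC :=
  {axiomOfEmptyset, axiomOfOrderedPairs, axiomOfExtensionality, axiomOfUnion, axiomOfPowerset,
    axiomOfInfinity, axiomOfRegularity, zornsLemma} ∪
  {f | ∃ (n : ℕ) (φ : Formula LZFC) (hφ : φ.BoundedBy (n + 2)), f = axiomOfCollection n φ hφ}

/-- The continuum hypothesis: `∀ x, Ord(x) → x ≤ ω ∨ 𝒫(ω) ≤ x`. -/
def CH : Sentence LZFC :=
  ⟨all (isOrdinal &0 ⟹ leqF &0 omegaT ⋎ leqF (powersetT omegaT) &0), by decide⟩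

end SetTheory

/-! Both halves come from Boolean-valued models. Over a complete Boolean algebra `B`, a name is a
`B`-weighted family of names, and every formula gets a value in `B`. Fix any ultrafilter `U` on `B`,
without genericity, and identify names whose equality has value in `U`. By the maximum principle
`exists_iSup_le`, the supremum of an extensional predicate over all names is attained, so `U`
commutes with quantifiers although it need not preserve infinite joins. Hence truth modulo `U` obeys
Tarski's clauses, natural deduction is sound (`sound`), and the axioms can be checked in the
quotient (`sat_of_mem_ZFC`).

In the quotient, an element of `A` need not be the class of a potential element of `A`. The
recurring device `holds_of_mem` turns a claim and its hypotheses into an inequality in `B`, which by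
`Ult.le_iff` may be tested on all ultrafilters `V`; there the element may be taken to be a potential
one.

For the failure of CH, `B` is the regular open algebra of 2^(P(ω₁) × ω), which adds distinct reals
indexed by P(ω₁). By the countable chain condition, a surjection in the model from part of a set
with potential elements indexed by `I` onto a set with distinct elements indexed by `K` would yield
an injection of `K` into `I × ℕ` (`not_leq_of_ccc`). So ω does not surject onto ω₁, nor ω₁ onto
P(ω), the latter by Cantor's theorem.

For CH, `B` is generated by the countable partial functions from ω₁ to P(ω). This forcing is
countably closed, so it adds no reals, and the generic function maps onto P(ω). An ordinal either
includes ω₁, hence surjects onto P(ω), or belongs to ω₁ and is countable (`sat_CH_of_collapse`). -/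

namespace BooleanModel

open FOL SetTheory

/-! ### Ultrafilters on Boolean algebras -/

/-- An ultrafilter on a Boolean algebra, presented by its membership predicate. -/
structure Ult (B : Type) [BooleanAlgebra B] where
  /-- Membership in the ultrafilter. -/
  holds : B → Prop
  holds_bot : ¬ holds ⊥
  holds_inf : ∀ a b, holds (a ⊓ b) ↔ holds a ∧ holds b
  holds_compl : ∀ a, holds aᶜ ↔ ¬ holds a

namespace Ult

variable {B : Type} [BooleanAlgebra B]

instance : CoeFun (Ult B) fun _ => B → Prop := ⟨Ult.holds⟩

variable (U : Ult B)

@[simp] theorem bot : ¬ U ⊥ := U.holds_bot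

@[simp] theorem inf {a b : B} : U (a ⊓ b) ↔ U a ∧ U b := U.holds_inf a b

@[simp] theorem compl {a : B} : U aᶜ ↔ ¬ U a := U.holds_compl a

@[simp] theorem top : U ⊤ := by rw [← compl_bot, U.compl]; exact U.bot

theorem mono {a b : B} (h : a ≤ b) (ha : U a) : U b := by
  rw [← inf_eq_left.2 h] at ha
  exact (U.inf.1 ha).2

@[simp] theorem sup {a b : B} : U (a ⊔ b) ↔ U a ∨ U b := by
  rw [← compl_compl (a ⊔ b), compl_sup, U.compl, U.inf, U.compl, U.compl]
  tauto

@[simp] theorem himp {a b : B} : U (a ⇨ b) ↔ (U a → U b) := by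
  rw [himp_eq]
  simp [or_comm, imp_iff_not_or]

/-- A prime ideal separates the principal filter of `a` from the zero ideal; its complement is the
ultrafilter. -/
theorem exists_of_ne_bot {a : B} (ha : a ≠ ⊥) : ∃ U : Ult B, U a := by
  obtain ⟨J, hJ, hI, hF⟩ := DistribLattice.prime_ideal_of_disjoint_filter_ideal
    (F := Order.PFilter.principal a) (I := (⊥ : Order.Ideal B)) (by
      rw [Set.disjoint_left]
      intro x hx hx'
      have hx' : x = ⊥ := le_bot_iff.1 hx'
      have hx : a ≤ x := by simpa using hx
      exact ha (le_bot_iff.1 (hx' ▸ hx)))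
  have haJ : a ∉ J := Set.disjoint_left.1 hF (by simp)
  refine ⟨⟨fun b => b ∉ J, by simp, fun b c => ?_, fun b => ?_⟩, haJ⟩
  · rw [← not_or, not_iff_not]
    exact ⟨hJ.mem_or_mem, fun h => h.elim (J.lower inf_le_left) (J.lower inf_le_right)⟩
  · rw [not_iff_not]
    constructor
    · intro h h'
      exact haJ (J.lower le_top (sup_compl_eq_top (x := b) ▸ Order.Ideal.sup_mem h' h))
    · intro h
      have : b ⊓ bᶜ ∈ J := by simp
      exact (hJ.mem_or_mem this).resolve_left h

/-- An inequality may be checked on ultrafilters. -/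
theorem le_iff {a b : B} : a ≤ b ↔ ∀ U : Ult B, U a → U b := by
  refine ⟨fun h U => U.mono h, fun h => ?_⟩
  by_contra hab
  have : a ⊓ bᶜ ≠ ⊥ := fun h' => hab (by rwa [← disjoint_iff, disjoint_compl_right_iff] at h')
  obtain ⟨U, hU⟩ := exists_of_ne_bot this
  simp only [inf, compl] at hU
  exact hU.2 (h U hU.1)

end Ult

/-! ### Names -/

/-- Names for sets in the Boolean-valued universe over `B`. -/
inductive Name (B : Type) : Type 1
  | mk (ι : Type) (el : ι → Name B) (wt : ι → B) : Name B

namespace Name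

variable {B : Type}

/-- The index type of a name. -/
def Idx : Name B → Type
  | mk ι _ _ => ι

/-- The potential elements of a name. -/
def el : (x : Name B) → x.Idx → Name B
  | mk _ a _ => a

/-- The weights of the potential elements. -/
def wt : (x : Name B) → x.Idx → B
  | mk _ _ φ => φ

variable [CompleteBooleanAlgebra B]

/-- The Boolean value of `x = y`. -/
noncomputable def eq : Name B → Name B → B
  | mk _ a φ, mk _ b ψ =>
    (⨅ i, φ i ⇨ ⨆ j, ψ j ⊓ eq (a i) (b j)) ⊓ (⨅ j, ψ j ⇨ ⨆ i, φ i ⊓ eq (a i) (b j))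

/-- The Boolean value of `x ∈ y`. -/
noncomputable def mem (x y : Name B) : B := ⨆ j, y.wt j ⊓ eq x (y.el j)

theorem eq_symm (x y : Name B) : eq x y = eq y x := by
  induction x generalizing y with
  | mk ι a φ ih =>
    cases y with
    | mk κ b ψ =>
      simp only [eq, ih]
      exact inf_comm _ _

theorem eq_def' (x y : Name B) :
    eq x y = (⨅ i, x.wt i ⇨ mem (x.el i) y) ⊓ (⨅ j, y.wt j ⇨ mem (y.el j) x) := by
  cases x with
  | mk ι a φ =>
    cases y with
    | mk κ b ψ =>
      rw [eq]
      simp only [mem, Idx, el, wt, eq_symm (b _)]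

@[simp] theorem eq_refl (x : Name B) : eq x x = ⊤ := by
  induction x with
  | mk ι a φ ih =>
    rw [eq_def', inf_idem, iInf_eq_top]
    intro i
    rw [himp_eq_top_iff]
    exact le_iSup_of_le (f := fun j => φ j ⊓ eq (a i) (a j)) i (by simp [ih i, wt])

theorem wt_le_mem (x : Name B) (i : x.Idx) : x.wt i ≤ mem (x.el i) x :=
  le_iSup_of_le i (by simp)

theorem eq_inf_wt_le (x y : Name B) (i : x.Idx) : eq x y ⊓ x.wt i ≤ mem (x.el i) y := by
  rw [eq_def', ← le_himp_iff]
  exact inf_le_left.trans (iInf_le _ i)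

/-- Each of the two inclusions follows from transitivity for triples of elements. Every such triple
contains an element of `x`, at one end or the other, so induction on `x` alone suffices. -/
theorem eq_trans (x y z : Name B) : eq x y ⊓ eq y z ≤ eq x z := by
  have key : ∀ x y z : Name B, (∀ i j k, eq (x.el i) (y.el j) ⊓ eq (y.el j) (z.el k) ≤
      eq (x.el i) (z.el k)) → eq x y ⊓ eq y z ≤ ⨅ i, x.wt i ⇨ mem (x.el i) z := by
    intro x y z ih
    refine le_iInf fun i => le_himp_iff.2 ?_
    calc eq x y ⊓ eq y z ⊓ x.wt i = (eq x y ⊓ x.wt i) ⊓ eq y z := by ac_rfl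
      _ ≤ mem (x.el i) y ⊓ eq y z := inf_le_inf_right _ (eq_inf_wt_le x y i)
      _ ≤ mem (x.el i) z := by
        rw [mem, iSup_inf_eq]
        refine iSup_le fun j => ?_
        calc y.wt j ⊓ eq (x.el i) (y.el j) ⊓ eq y z
            = (eq y z ⊓ y.wt j) ⊓ eq (x.el i) (y.el j) := by ac_rfl
          _ ≤ mem (y.el j) z ⊓ eq (x.el i) (y.el j) := inf_le_inf_right _ (eq_inf_wt_le y z j)
          _ ≤ mem (x.el i) z := by
            rw [mem, mem, iSup_inf_eq]
            refine iSup_mono fun k => ?_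
            rw [inf_assoc, inf_comm (eq (y.el j) _)]
            exact inf_le_inf_left _ (ih i j k)
  induction x generalizing y z with
  | mk ι a φ ih =>
    rw [eq_def' (mk ι a φ) z]
    refine le_inf (key (mk ι a φ) y z fun i _ _ => ih i _ _) ?_
    rw [inf_comm, eq_symm y z, eq_symm (mk ι a φ) y]
    refine key z y (mk ι a φ) fun k j i => ?_
    rw [inf_comm, eq_symm (z.el k), eq_symm (y.el j), eq_symm (z.el k)]
    exact ih i _ _

/-! ### Extensional predicates, mixing and the maximum principle -/

/-- A `B`-valued predicate on names which respects the Boolean-valued equality. -/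
def Ext (F : Name B → B) : Prop := ∀ x y, eq x y ⊓ F x ≤ F y

theorem ext_mem_left (z : Name B) : Ext fun x => mem x z := by
  intro x y
  dsimp only
  rw [mem, inf_iSup_eq]
  refine iSup_mono fun k => ?_
  rw [inf_left_comm, eq_symm x y]
  exact inf_le_inf_left _ (eq_trans y x _)

theorem ext_mem_right (z : Name B) : Ext fun x => mem z x := by
  intro x y
  dsimp only
  rw [mem, inf_iSup_eq]
  refine iSup_le fun k => ?_
  calc eq x y ⊓ (x.wt k ⊓ eq z (x.el k)) = eq (x.el k) z ⊓ (eq x y ⊓ x.wt k) := by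
        rw [eq_symm z]; ac_rfl
    _ ≤ eq (x.el k) z ⊓ mem (x.el k) y := inf_le_inf_left _ (eq_inf_wt_le x y k)
    _ ≤ mem z y := ext_mem_left y _ _

theorem ext_eq_right (z : Name B) : Ext fun x => eq z x := by
  intro x y
  dsimp only
  rw [inf_comm]
  exact eq_trans z x y

theorem Ext.inf {F G : Name B → B} (hF : Ext F) (hG : Ext G) : Ext fun x => F x ⊓ G x :=
  fun x y => le_inf ((inf_le_inf_left _ inf_le_left).trans (hF x y))
    ((inf_le_inf_left _ inf_le_right).trans (hG x y))

theorem Ext.himp {F G : Name B → B} (hF : Ext F) (hG : Ext G) : Ext fun x => F x ⇨ G x := by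
  intro x y
  rw [le_himp_iff]
  have h1 : eq x y ⊓ F y ≤ F x := by rw [eq_symm]; exact hF y x
  calc eq x y ⊓ (F x ⇨ G x) ⊓ F y = eq x y ⊓ ((F x ⇨ G x) ⊓ (eq x y ⊓ F y)) := by
        rw [← inf_assoc, ← inf_assoc, inf_right_comm (eq x y) _ (eq x y), inf_idem]
    _ ≤ eq x y ⊓ ((F x ⇨ G x) ⊓ F x) := inf_le_inf_left _ (inf_le_inf_left _ h1)
    _ ≤ eq x y ⊓ G x := inf_le_inf_left _ (by rw [himp_inf_self]; exact inf_le_left)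
    _ ≤ G y := hG x y

theorem Ext.const (b : B) : Ext fun _ => b := fun _ _ => inf_le_right

theorem Ext.compl {F : Name B → B} (hF : Ext F) : Ext fun x => (F x)ᶜ := by
  simpa using hF.himp (Ext.const ⊥)

/-- Bounded existential quantification only needs to consider the potential elements. -/
theorem iSup_wt_inf {F : Name B → B} (hF : Ext F) (A : Name B) :
    ⨆ i, A.wt i ⊓ F (A.el i) = ⨆ x, mem x A ⊓ F x := by
  apply le_antisymm
  · exact iSup_le fun i => le_iSup_of_le (A.el i) (inf_le_inf_right _ (wt_le_mem A i))
  · refine iSup_le fun x => ?_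
    rw [mem, iSup_inf_eq]
    refine iSup_mono fun i => ?_
    rw [inf_assoc]
    exact inf_le_inf_left _ (hF x _)

/-- Bounded universal quantification only needs to consider the potential elements. -/
theorem iInf_wt_himp {F : Name B → B} (hF : Ext F) (A : Name B) :
    ⨅ i, A.wt i ⇨ F (A.el i) = ⨅ x, mem x A ⇨ F x := by
  have := congrArg (fun b : B => bᶜ) (iSup_wt_inf hF.compl A)
  simpa [compl_iSup, compl_inf, himp_eq, sup_comm] using this

/-- Mixing: pool the elements of all `x i`, cutting their weights down by `c i`. Below `c i` only
the elements of `x i` survive, because the `c j` are disjoint. -/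
theorem exists_mix {ι : Type} (c : ι → B) (x : ι → Name B) (h : Pairwise fun i j => c i ⊓ c j = ⊥) :
    ∃ z, ∀ i, c i ≤ eq z (x i) := by
  refine ⟨mk (Σ i, (x i).Idx) (fun p => (x p.1).el p.2) (fun p => c p.1 ⊓ (x p.1).wt p.2), ?_⟩
  intro i
  rw [eq_def']
  refine le_inf (le_iInf ?_) (le_iInf fun k => ?_)
  · rintro ⟨j, k⟩
    rw [le_himp_iff]
    change c i ⊓ (c j ⊓ (x j).wt k) ≤ mem ((x j).el k) (x i)
    by_cases hij : i = j
    · subst hij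
      exact inf_le_right.trans (inf_le_right.trans (wt_le_mem _ _))
    · rw [← inf_assoc, h hij]
      simp
  · rw [le_himp_iff]
    exact le_iSup_of_le (f := fun p : Σ i, (x i).Idx => (c p.1 ⊓ (x p.1).wt p.2) ⊓
      eq ((x i).el k) ((x p.1).el p.2)) ⟨i, k⟩ (by simp)

theorem exists_forall_le {F : Name B → B} (hF : Ext F) {ι : Type} (x : ι → Name B) :
    ∃ z, ∀ i, F (x i) ≤ F z := by
  obtain ⟨_, _⟩ := exists_wellFoundedLT ι
  -- Along a well-order, `c i` is what `F (x i)` adds to the earlier values: a disjoint family with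
  -- the same join.
  let c : ι → B := fun i => F (x i) ⊓ (⨆ j : {j : ι // j < i}, F (x j))ᶜ
  have hc : ∀ i, F (x i) ≤ ⨆ j, c j := by
    intro i
    induction i using WellFoundedLT.induction with
    | _ i ih =>
      have h1 : (⨆ j : {j : ι // j < i}, F (x j)) ≤ ⨆ j, c j := iSup_le fun j => ih j.1 j.2
      calc F (x i) ≤ (⨆ j : {j : ι // j < i}, F (x j)) ⊔ c i := by
            rw [sup_inf_left, sup_compl_eq_top, inf_top_eq]; exact le_sup_right
        _ ≤ ⨆ j, c j := sup_le h1 (le_iSup c i)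
  have hlt : ∀ i j : ι, i < j → c i ⊓ c j = ⊥ := by
    intro i j hij
    rw [← le_bot_iff, ← inf_compl_eq_bot (a := F (x i))]
    refine inf_le_inf inf_le_left (inf_le_right.trans ?_)
    exact compl_le_compl (le_iSup (fun k : {k : ι // k < j} => F (x k)) ⟨i, hij⟩)
  obtain ⟨z, hz⟩ := exists_mix c x (fun i j hij => by
    rcases lt_or_gt_of_ne hij with h | h
    · exact hlt _ _ h
    · rw [inf_comm]; exact hlt _ _ h)
  refine ⟨z, fun i => (hc i).trans (iSup_le fun j => ?_)⟩
  refine le_trans (le_inf ?_ inf_le_left) (hF (x j) z)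
  rw [eq_symm]
  exact hz j

/-- The maximum principle. -/
theorem exists_iSup_le {F : Name B → B} (hF : Ext F) : ∃ z, ⨆ x, F x ≤ F z := by
  -- Names form a large type, so one name is chosen for each attained value in the small type `B`.
  choose rep hrep using fun b : {b : B // ∃ x, F x = b} => b.2
  obtain ⟨z, hz⟩ := exists_forall_le hF rep
  exact ⟨z, iSup_le fun x => (hrep ⟨F x, x, rfl⟩).ge.trans (hz _)⟩

end Name

open Name

variable {B : Type} [CompleteBooleanAlgebra B]

/-- An ultrafilter need not respect infinite joins, but this join is attained by the maximum
principle. -/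
theorem Ult.iSup_iff (U : Ult B) {F : Name B → B} (hF : Ext F) :
    U (⨆ x, F x) ↔ ∃ x, U (F x) := by
  constructor
  · intro h
    obtain ⟨z, hz⟩ := exists_iSup_le hF
    exact ⟨z, U.mono hz h⟩
  · rintro ⟨x, hx⟩
    exact U.mono (le_iSup F x) hx

theorem Ult.iInf_iff (U : Ult B) {F : Name B → B} (hF : Ext F) :
    U (⨅ x, F x) ↔ ∀ x, U (F x) := by
  have := not_congr (U.iSup_iff hF.compl)
  rw [← U.compl, compl_iSup] at this
  simpa using this

end BooleanModel

namespace BooleanModel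

open FOL SetTheory Name

variable {B : Type} [CompleteBooleanAlgebra B]

/-! ### The two-valued quotient -/

/-- Equality of names modulo an ultrafilter. -/
def nameSetoid (U : Ult B) : Setoid (Name B) where
  r x y := U (eq x y)
  iseqv :=
    { refl := fun x => by simp
      symm := fun {x y} h => by rwa [eq_symm]
      trans := fun {x y z} hxy hyz => U.mono (eq_trans x y z) (U.inf.2 ⟨hxy, hyz⟩) }

/-- The quotient of the Boolean-valued universe by an ultrafilter. -/
def Universe (U : Ult B) : Type 1 := Quotient (nameSetoid U)

/-- The class of a name. -/
def cls (U : Ult B) (x : Name B) : Universe U := Quotient.mk (nameSetoid U) x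

variable {U : Ult B}

theorem Universe.exists_rep (m : Universe U) : ∃ x, cls U x = m := Quotient.exists_rep m

theorem Universe.forall_iff {p : Universe U → Prop} : (∀ m, p m) ↔ ∀ x, p (cls U x) :=
  ⟨fun h x => h _, fun h m => by obtain ⟨x, rfl⟩ := m.exists_rep; exact h x⟩

theorem holds_eq {x y : Name B} : U (eq x y) ↔ cls U x = cls U y :=
  ⟨fun h => Quotient.sound (s := nameSetoid U) h, fun h => Quotient.exact (s := nameSetoid U) h⟩

theorem Name.Ext.holds_congr {F : Name B → B} (hF : Ext F) {x y : Name B}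
    (h : cls U x = cls U y) : U (F x) ↔ U (F y) :=
  ⟨fun h' => U.mono (hF x y) (U.inf.2 ⟨holds_eq.2 h, h'⟩),
    fun h' => U.mono (hF y x) (U.inf.2 ⟨holds_eq.2 h.symm, h'⟩)⟩

instance : Membership (Universe U) (Universe U) where
  mem y x := Quotient.liftOn₂ x y (fun x y => U (mem x y)) fun _ b c _ h h' =>
    propext (((ext_mem_left b).holds_congr (holds_eq.1 h)).trans
      ((ext_mem_right c).holds_congr (holds_eq.1 h')))

theorem holds_mem {x y : Name B} : U (mem x y) ↔ cls U x ∈ cls U y := Iff.rfl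

theorem holds_iSup_wt_inf {F : Name B → B} (hF : Ext F) (A : Name B) :
    U (⨆ i, A.wt i ⊓ F (A.el i)) ↔ ∃ x, cls U x ∈ cls U A ∧ U (F x) := by
  rw [iSup_wt_inf hF, U.iSup_iff ((ext_mem_left A).inf hF)]
  simp [holds_mem]

theorem holds_iInf_wt_himp {F : Name B → B} (hF : Ext F) (A : Name B) :
    U (⨅ i, A.wt i ⇨ F (A.el i)) ↔ ∀ x, cls U x ∈ cls U A → U (F x) := by
  rw [iInf_wt_himp hF, U.iInf_iff ((ext_mem_left A).himp hF)]
  simp [holds_mem]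

theorem Universe.ext {a b : Universe U} (h : ∀ z, z ∈ a ↔ z ∈ b) : a = b := by
  obtain ⟨x, rfl⟩ := a.exists_rep
  obtain ⟨y, rfl⟩ := b.exists_rep
  rw [← holds_eq, eq_def', U.inf, holds_iInf_wt_himp (ext_mem_left y),
    holds_iInf_wt_himp (ext_mem_left x)]
  exact ⟨fun z => (h _).1, fun z => (h _).2⟩

/-! ### Set operations on names -/

namespace Name

/-- The empty set. -/
def empty : Name B := mk Empty Empty.elim Empty.elim

/-- The unordered pair. -/
def upair (x y : Name B) : Name B := mk Bool (fun b => cond b x y) fun _ => ⊤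

/-- The Kuratowski pair. -/
def opair (x y : Name B) : Name B := upair (upair x x) (upair x y)

/-- The union of a set. -/
def sUnion (u : Name B) : Name B :=
  mk (Σ i, (u.el i).Idx) (fun p => (u.el p.1).el p.2) fun p => u.wt p.1 ⊓ (u.el p.1).wt p.2

/-- The subset of `z` with prescribed weights. -/
def restrict (z : Name B) (χ : z.Idx → B) : Name B := mk z.Idx z.el fun i => z.wt i ⊓ χ i

/-- The power set. -/
def power (z : Name B) : Name B := mk (z.Idx → B) z.restrict fun _ => ⊤

end Name

@[simp] theorem notMem_empty (m : Universe U) : m ∉ cls U empty := by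
  obtain ⟨x, rfl⟩ := m.exists_rep
  have h : mem x (empty : Name B) = ⊥ := iSup_of_empty (ι := Empty) _
  rw [← holds_mem, h]
  exact U.bot

@[simp] theorem mem_upair {m : Universe U} {x y : Name B} :
    m ∈ cls U (upair x y) ↔ m = cls U x ∨ m = cls U y := by
  obtain ⟨z, rfl⟩ := m.exists_rep
  have h : mem z (upair x y) = eq z x ⊔ eq z y := by
    refine (iSup_bool_eq (f := fun b : Bool => (⊤ : B) ⊓ eq z (cond b x y))).trans ?_
    simp
  rw [← holds_mem, h, U.sup, holds_eq, holds_eq]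

theorem opair_inj {x y z w : Name B} :
    cls U (opair x y) = cls U (opair z w) ↔ cls U x = cls U z ∧ cls U y = cls U w := by
  have hS : ∀ a b c d : Name B, cls U a = cls U c → cls U b = cls U d →
      cls U (upair a b) = cls U (upair c d) := fun _ b c _ h h' =>
    Universe.ext fun m => by simp [h, h']
  constructor
  · intro h
    have h1 : ∀ a b : Name B, cls U (upair a b) ∈ cls U (opair x y) ↔
        cls U (upair a b) ∈ cls U (opair z w) := by simp [h]
    have h0 : ∀ a b c d : Name B, cls U (upair a b) = cls U (upair c d) ↔
        ((cls U a = cls U c ∧ cls U b = cls U d) ∨ (cls U a = cls U d ∧ cls U b = cls U c)) := by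
      intro a b c d
      constructor
      · intro h
        have h2 : ∀ m, m ∈ cls U (upair a b) ↔ m ∈ cls U (upair c d) := by simp [h]
        simp only [mem_upair] at h2
        have := h2 (cls U a)
        have := h2 (cls U b)
        have := h2 (cls U c)
        have := h2 (cls U d)
        grind
      · rintro (⟨h, h'⟩ | ⟨h, h'⟩)
        · exact hS _ _ _ _ h h'
        · refine Universe.ext fun m => ?_
          simp [h, h', or_comm]
    simp only [opair, mem_upair, h0] at h1
    -- Comparing membership of these four unordered pairs already determines the components.
    have := h1 x x
    have := h1 x y
    have := h1 z z
    have := h1 z w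
    grind
  · rintro ⟨h, h'⟩
    exact hS _ _ _ _ (hS _ _ _ _ h h) (hS _ _ _ _ h h')

theorem mem_sUnion {m : Universe U} {u : Name B} :
    m ∈ cls U (sUnion u) ↔ ∃ n, n ∈ cls U u ∧ m ∈ n := by
  obtain ⟨x, rfl⟩ := m.exists_rep
  have h : mem x (sUnion u) = ⨆ i, u.wt i ⊓ mem x (u.el i) := by
    refine (iSup_sigma (f := fun p : Σ i, (u.el i).Idx =>
      (u.wt p.1 ⊓ (u.el p.1).wt p.2) ⊓ eq x ((u.el p.1).el p.2))).trans ?_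
    simp only [mem, inf_iSup_eq, inf_assoc]
  rw [← holds_mem, h, holds_iSup_wt_inf (ext_mem_right x)]
  constructor
  · rintro ⟨y, h, h'⟩
    exact ⟨_, h, h'⟩
  · rintro ⟨n, h, h'⟩
    obtain ⟨y, rfl⟩ := n.exists_rep
    exact ⟨y, h, h'⟩

theorem mem_restrict {F : Name B → B} (hF : Ext F) {x z : Name B} :
    cls U x ∈ cls U (z.restrict fun i => F (z.el i)) ↔ cls U x ∈ cls U z ∧ U (F x) := by
  have h : mem x (z.restrict fun i => F (z.el i)) = ⨆ i, z.wt i ⊓ (F (z.el i) ⊓ eq x (z.el i)) := by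
    simp only [← inf_assoc]
    rfl
  rw [← holds_mem, h, holds_iSup_wt_inf (hF.inf (ext_eq_right x))]
  constructor
  · rintro ⟨y, hy, h⟩
    rw [U.inf, holds_eq] at h
    rw [h.2, hF.holds_congr h.2]
    exact ⟨hy, h.1⟩
  · rintro ⟨h, h'⟩
    exact ⟨x, h, by simp [h']⟩

theorem restrict_subset {z : Name B} {χ : z.Idx → B} {m : Universe U}
    (h : m ∈ cls U (z.restrict χ)) : m ∈ cls U z := by
  obtain ⟨x, rfl⟩ := m.exists_rep
  exact U.mono (iSup_mono fun i => inf_le_inf_right _ inf_le_left) h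

theorem cls_restrict_mem {y z : Name B} (h : ∀ m, m ∈ cls U y → m ∈ cls U z) :
    cls U (z.restrict fun i => mem (z.el i) y) = cls U y := by
  refine Universe.ext fun m => ?_
  obtain ⟨x, rfl⟩ := m.exists_rep
  rw [mem_restrict (ext_mem_left y), holds_mem]
  exact ⟨fun h => h.2, fun h' => ⟨h _ h', h'⟩⟩

theorem mem_power {m : Universe U} {z : Name B} :
    m ∈ cls U (power z) ↔ ∀ n, n ∈ m → n ∈ cls U z := by
  obtain ⟨y, rfl⟩ := m.exists_rep
  constructor
  · intro h
    rw [Universe.forall_iff]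
    intro x hx
    -- The value of membership in the power set is a join over all `χ`, which `U` may not split;
    -- hence an inequality in `B`.
    have h1 : mem y (power z) ≤ mem x y ⇨ mem x z := by
      refine iSup_le fun χ => ?_
      rw [Ult.le_iff]
      intro V hV
      rw [V.himp]
      intro hxy
      have hV : cls V y = cls V (z.restrict χ) := holds_eq.1 (V.inf.1 hV).2
      rw [holds_mem, hV] at hxy
      exact restrict_subset hxy
    exact U.himp.1 (U.mono h1 h) hx
  · intro h
    have h1 : eq y (z.restrict fun i => mem (z.el i) y) ≤ mem y (power z) :=
      le_iSup_of_le (f := fun χ : z.Idx → B => (⊤ : B) ⊓ eq y (z.restrict χ)) _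
        (le_inf le_top le_rfl)
    exact U.mono h1 (holds_eq.2 (cls_restrict_mem h).symm)

theorem Universe.exists_sep {F : Name B → B} (hF : Ext F) (m : Universe U) :
    ∃ s : Universe U, ∀ x, cls U x ∈ s ↔ cls U x ∈ m ∧ U (F x) := by
  obtain ⟨z, rfl⟩ := m.exists_rep
  exact ⟨_, fun x => mem_restrict hF⟩

theorem Universe.exists_inter (a b : Universe U) : ∃ c : Universe U, ∀ m, m ∈ c ↔ m ∈ a ∧ m ∈ b := by
  obtain ⟨y, rfl⟩ := b.exists_rep
  simpa only [forall_iff, holds_mem] using exists_sep (ext_mem_left y) a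

theorem Universe.exists_diff (a b : Universe U) : ∃ c : Universe U, ∀ m, m ∈ c ↔ m ∈ a ∧ m ∉ b := by
  obtain ⟨y, rfl⟩ := b.exists_rep
  simpa only [forall_iff, Ult.compl, holds_mem] using exists_sep (ext_mem_left y).compl a

/-- The quotient need not be externally well-founded. A counterexample is therefore pulled back to
the Boolean value `⨅ y, G y`, that every member of `x` meets `x`, and refuted by induction on names.
-/
theorem Universe.regularity {a m : Universe U} (hm : m ∈ a) : ∃ n ∈ a, ∀ k ∈ a, k ∉ n := by
  obtain ⟨x, rfl⟩ := a.exists_rep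
  by_contra! hcon
  let G : Name B → B := fun y => mem y x ⇨ ⨆ i, x.wt i ⊓ mem (x.el i) y
  have hG : Ext G := by
    refine (ext_mem_left x).himp fun y z => ?_
    rw [inf_iSup_eq]
    refine iSup_mono fun i => ?_
    rw [inf_left_comm]
    exact inf_le_inf_left _ (ext_mem_right _ y z)
  have hU : U (⨅ y, G y) := by
    rw [U.iInf_iff hG]
    intro y
    rw [U.himp, holds_mem, holds_iSup_wt_inf (ext_mem_left y)]
    intro hy
    obtain ⟨k, hk, hky⟩ := hcon _ hy
    obtain ⟨z, rfl⟩ := k.exists_rep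
    exact ⟨z, hk, hky⟩
  have key : ∀ y, (⨅ y, G y) ⊓ mem y x ≤ ⊥ := by
    intro y
    induction y with
    | mk ι b ψ ih =>
      have h1 : (⨅ y, G y) ⊓ mem (mk ι b ψ) x ≤ ⨆ i, x.wt i ⊓ mem (x.el i) (mk ι b ψ) := by
        rw [← le_himp_iff]
        exact iInf_le _ _
      refine (le_inf inf_le_left h1).trans ?_
      rw [inf_iSup_eq]
      refine iSup_le fun i => ?_
      simp only [mem, inf_iSup_eq]
      refine iSup_le fun (j : ι) => le_trans ?_ (ih j)
      refine inf_le_inf_left _ ?_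
      calc x.wt i ⊓ (ψ j ⊓ eq (x.el i) (b j)) ≤ eq (x.el i) (b j) ⊓ mem (x.el i) x :=
            le_inf (inf_le_right.trans inf_le_right) (inf_le_left.trans (wt_le_mem x i))
        _ ≤ mem (b j) x := ext_mem_left x _ _
  obtain ⟨y, rfl⟩ := m.exists_rep
  exact U.bot (U.mono (key y) (U.inf.2 ⟨hU, hm⟩))

end BooleanModel

namespace BooleanModel

open FOL SetTheory Name

/-! ### Valuations of the variables -/

section Valuation

variable {B : Type}

/-- Extend a valuation by a new value for the variable `0`. -/
def scons (x : Name B) (v : ℕ → Name B) : ℕ → Name B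
  | 0 => x
  | n + 1 => v n

infixr:67 " ∷ " => scons

section

variable {v : ℕ → Name B} {x : Name B}

@[simp] theorem scons_zero : (x ∷ v) 0 = x := rfl

@[simp] theorem scons_one : (x ∷ v) 1 = v 0 := rfl

@[simp] theorem scons_two : (x ∷ v) 2 = v 1 := rfl

@[simp] theorem scons_three : (x ∷ v) 3 = v 2 := rfl

end

/-- Insert a new value for the variable `n` into a valuation. -/
def insertVal (v : ℕ → Name B) (x : Name B) (n : ℕ) : ℕ → Name B :=
  fun k => if k < n then v k else if k = n then x else v (k - 1)

theorem insertVal_zero (v : ℕ → Name B) (x : Name B) : insertVal v x 0 = x ∷ v := by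
  funext k
  cases k <;> simp [insertVal, scons]

theorem insertVal_succ (v : ℕ → Name B) (x y : Name B) (n : ℕ) :
    insertVal (y ∷ v) x (n + 1) = y ∷ insertVal v x n := by
  funext k
  cases k with
  | zero => simp [insertVal, scons]
  | succ k =>
    rcases lt_trichotomy k n with h | h | h
    · simp [insertVal, scons, h]
    · simp [insertVal, scons, h]
    · obtain ⟨j, rfl⟩ : ∃ j, k = j + 1 := ⟨k - 1, by omega⟩
      simp [insertVal, scons, h.ne', show ¬ j + 1 < n by omega]

end Valuation

variable {B : Type} [CompleteBooleanAlgebra B]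

/-! ### Names of well-orders -/

namespace Name

/-- The canonical name of the ordinal of an element of a well-order. -/
noncomputable def ord {W : Type} [LinearOrder W] [WellFoundedLT W] : W → Name B :=
  (wellFounded_lt (α := W)).fix fun w ih =>
    mk {v : W // v < w} (fun v => ih v.1 v.2) fun _ => ⊤

theorem ord_eq {W : Type} [LinearOrder W] [WellFoundedLT W] (w : W) :
    (ord w : Name B) = mk {v : W // v < w} (fun v => ord v.1) fun _ => ⊤ :=
  WellFounded.fix_eq _ _ _

/-- The canonical name of the order type of a well-order. -/
noncomputable def ordType (W : Type) [LinearOrder W] [WellFoundedLT W] : Name B := mk W ord fun _ => ⊤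

end Name

/-! ### Boolean-valued semantics -/

/-- The interpretation of function symbols. -/
noncomputable def fn : {l : ℕ} → ZFCFunc l → (Fin l → Name B) → Name B
  | _, .emptyset, _ => empty
  | _, .pr, xs => opair (xs 0) (xs 1)
  | _, .omega, _ => ordType ℕ
  | _, .powerset, xs => power (xs 0)
  | _, .union, xs => sUnion (xs 0)

/-- The interpretation of relation symbols. -/
noncomputable def rl : {l : ℕ} → ZFCRel l → (Fin l → Name B) → B
  | _, .mem, xs => mem (xs 0) (xs 1)

/-- The value of a partially applied term. -/
noncomputable def eval : {l : ℕ} → Preterm LZFC l → (ℕ → Name B) → (Fin l → Name B) → Name B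
  | _, .var k, v, _ => v k
  | _, .func f, _, xs => fn f xs
  | _, .app s t, v, xs => eval s v (Fin.cons (eval t v ![]) xs)

/-- The Boolean value of a partially applied formula. -/
noncomputable def val : {l : ℕ} → Preformula LZFC l → (ℕ → Name B) → (Fin l → Name B) → B
  | _, .falsum, _, _ => ⊥
  | _, .equal s t, v, _ => eq (eval s v ![]) (eval t v ![])
  | _, .rel R, _, xs => rl R xs
  | _, .apprel f t, v, xs => val f v (Fin.cons (eval t v ![]) xs)
  | _, .imp f g, v, _ => val f v ![] ⇨ val g v ![]
  | _, .all f, v, _ => ⨅ x, val f (x ∷ v) ![]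

theorem fn_congr {U : Ult B} {l : ℕ} (f : ZFCFunc l) {xs ys : Fin l → Name B}
    (h : ∀ k, cls U (xs k) = cls U (ys k)) : cls U (fn f xs) = cls U (fn f ys) := by
  cases f with
  | emptyset => rfl
  | omega => rfl
  | pr => exact opair_inj.2 ⟨h 0, h 1⟩
  | powerset => exact Universe.ext fun m => by simp only [fn, mem_power, h]
  | union => exact Universe.ext fun m => by simp only [fn, mem_sUnion, h]

theorem eval_congr {l : ℕ} (t : Preterm LZFC l) {v w : ℕ → Name B} {xs ys : Fin l → Name B} {c : B}
    (hv : ∀ k, c ≤ eq (v k) (w k)) (hx : ∀ k, c ≤ eq (xs k) (ys k)) :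
    c ≤ eq (eval t v xs) (eval t w ys) := by
  induction t with
  | var k => exact hv k
  | func f =>
    rw [Ult.le_iff]
    exact fun U hU => holds_eq.2 (fn_congr f fun k => holds_eq.1 (U.mono (hx k) hU))
  | app s t ihs iht =>
    refine ihs fun k => ?_
    refine Fin.cases ?_ (fun k => ?_) k
    · exact iht fun k => k.elim0
    · exact hx k

/-- The bound `c` lives in `B` rather than in the quotient because `U` is known to commute with the
infimum over names only once `ext_val` is available. -/
theorem val_congr {l : ℕ} (f : Preformula LZFC l) {v w : ℕ → Name B} {xs ys : Fin l → Name B} {c : B}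
    (hv : ∀ k, c ≤ eq (v k) (w k)) (hx : ∀ k, c ≤ eq (xs k) (ys k)) :
    c ⊓ val f v xs ≤ val f w ys := by
  induction f generalizing v w with
  | falsum => simp [val]
  | equal s t =>
    rw [Ult.le_iff]
    intro U hU
    simp only [val, U.inf, holds_eq] at hU ⊢
    have h : ∀ t : Term LZFC, cls U (eval t v ![]) = cls U (eval t w ![]) := fun t =>
      holds_eq.1 (U.mono (eval_congr t hv fun k => k.elim0) hU.1)
    rw [← h, ← h]
    exact hU.2
  | rel R =>
    cases R
    rw [Ult.le_iff]
    intro U hU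
    simp only [val, rl, U.inf, holds_mem] at hU ⊢
    rw [← holds_eq.1 (U.mono (hx 0) hU.1), ← holds_eq.1 (U.mono (hx 1) hU.1)]
    exact hU.2
  | apprel f t ih =>
    refine ih hv fun k => ?_
    refine Fin.cases ?_ (fun k => ?_) k
    · exact eval_congr t hv fun k => k.elim0
    · exact hx k
  | imp f g ihf ihg =>
    rw [Ult.le_iff]
    intro U hU
    simp only [val, U.inf, U.himp] at hU ⊢
    intro hf
    refine U.mono (ihg hv fun k => k.elim0) (U.inf.2 ⟨hU.1, hU.2 ?_⟩)
    refine U.mono (ihf (fun k => ?_) fun k => k.elim0) (U.inf.2 ⟨hU.1, hf⟩)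
    rw [eq_symm]
    exact hv k
  | all f ih =>
    refine le_iInf fun x => (inf_le_inf_left c (iInf_le _ x)).trans (ih (fun k => ?_) fun k => k.elim0)
    cases k with
    | zero => simp [scons]
    | succ k => exact hv k

theorem ext_val (f : Formula LZFC) (v : ℕ → Name B) : Ext fun x => val f (x ∷ v) ![] := by
  intro x y
  refine val_congr f (fun k => ?_) fun k => k.elim0
  cases k with
  | zero => exact le_rfl
  | succ k => simp [scons]

/-! ### Soundness -/

theorem eval_lift {l : ℕ} (t : Preterm LZFC l) (n m : ℕ) (v : ℕ → Name B) (xs : Fin l → Name B) :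
    eval (t.lift n m) v xs = eval t (fun k => v (if m ≤ k then k + n else k)) xs := by
  induction t with
  | var k => rfl
  | func f => rfl
  | app s t ihs iht => simp only [Preterm.lift, eval, ihs, iht]

theorem val_lift {l : ℕ} (f : Preformula LZFC l) (n m : ℕ) (v : ℕ → Name B) (xs : Fin l → Name B) :
    val (f.lift n m) v xs = val f (fun k => v (if m ≤ k then k + n else k)) xs := by
  induction f generalizing m v with
  | falsum => rfl
  | equal s t => simp only [Preformula.lift, val, eval_lift]
  | rel R => rfl
  | apprel f t ih => simp only [Preformula.lift, val, eval_lift, ih]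
  | imp f g ihf ihg => simp only [Preformula.lift, val, ihf, ihg]
  | all f ih =>
    simp only [Preformula.lift, val, ih]
    congr! 3 with x
    funext k
    cases k with
    | zero => simp [scons]
    | succ k =>
      by_cases h : m ≤ k
      · simp [scons, h, Nat.add_right_comm k 1 n]
      · simp [scons, h]

/-- Substitution at `n` lifts `s` by `n`, so `s` is read in the valuation shifted by `n`. -/
theorem eval_subst {l : ℕ} (t : Preterm LZFC l) (s : Term LZFC) (n : ℕ) (v : ℕ → Name B)
    (xs : Fin l → Name B) :
    eval (t.subst s n) v xs = eval t (insertVal v (eval s (fun k => v (k + n)) ![]) n) xs := by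
  induction t with
  | var k =>
    rw [Subsingleton.elim xs ![]]
    simp only [Preterm.subst, eval, insertVal]
    split_ifs
    · rfl
    · simp [eval_lift]
    · rfl
  | func f => rfl
  | app t₁ t₂ ih₁ ih₂ => simp only [Preterm.subst, eval, ih₁, ih₂]

theorem val_subst {l : ℕ} (f : Preformula LZFC l) (s : Term LZFC) (n : ℕ) (v : ℕ → Name B)
    (xs : Fin l → Name B) :
    val (f.subst s n) v xs = val f (insertVal v (eval s (fun k => v (k + n)) ![]) n) xs := by
  induction f generalizing n v with
  | falsum => rfl
  | equal t₁ t₂ => simp only [Preformula.subst, val, eval_subst]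
  | rel R => rfl
  | apprel f t ih => simp only [Preformula.subst, val, eval_subst, ih]
  | imp f g ihf ihg => simp only [Preformula.subst, val, ihf, ihg]
  | all f ih =>
    simp only [Preformula.subst, val, ih, insertVal_succ]
    rfl

/-- Satisfaction of a formula modulo an ultrafilter. -/
def Sat (U : Ult B) (v : ℕ → Name B) (f : Formula LZFC) : Prop := U (val f v ![])

section Sat

variable {U : Ult B} {v : ℕ → Name B} {f g : Formula LZFC} {s t : Term LZFC}

@[simp] theorem sat_falsum : ¬ Sat U v Preformula.falsum := U.bot

@[simp] theorem sat_equal : Sat U v (s ≐ t) ↔ cls U (eval s v ![]) = cls U (eval t v ![]) := holds_eq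

@[simp] theorem sat_mem : Sat U v (s ∊ t) ↔ cls U (eval s v ![]) ∈ cls U (eval t v ![]) := Iff.rfl

@[simp] theorem sat_imp : Sat U v (f ⟹ g) ↔ (Sat U v f → Sat U v g) := U.himp

@[simp] theorem sat_all : Sat U v (FOL.all f) ↔ ∀ x, Sat U (x ∷ v) f := U.iInf_iff (ext_val f v)

@[simp] theorem sat_neg : Sat U v (neg f) ↔ ¬ Sat U v f := by simp [neg]

@[simp] theorem sat_disj : Sat U v (f ⋎ g) ↔ Sat U v f ∨ Sat U v g := by
  simp [disj, or_iff_not_imp_left]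

@[simp] theorem sat_conj : Sat U v (f ⋏ g) ↔ Sat U v f ∧ Sat U v g := by simp [conj]

@[simp] theorem sat_bicond : Sat U v (f ⟺ g) ↔ (Sat U v f ↔ Sat U v g) := by
  simp [bicond, iff_def]

@[simp] theorem sat_ex : Sat U v (ex f) ↔ ∃ x, Sat U (x ∷ v) f := by simp [ex]

end Sat

/-- Soundness of natural deduction. -/
theorem sound (U : Ult B) {Γ : Set (Formula LZFC)} {f : Formula LZFC} (h : Prf Γ f) :
    ∀ v : ℕ → Name B, (∀ g ∈ Γ, Sat U v g) → Sat U v f := by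
  have subst_iff : ∀ (v : ℕ → Name B) (g : Formula LZFC) (t : Term LZFC),
      Sat U v (g.subst t 0) ↔ Sat U (eval t v ![] ∷ v) g := by
    intro v g t
    rw [Sat, val_subst, insertVal_zero]
    rfl
  induction h with
  | axm Γ A h => exact fun v hv => hv A h
  | impI Γ A B' _ ih =>
    intro v hv
    rw [sat_imp]
    intro hA
    exact ih v fun g hg => hg.elim (fun h => h ▸ hA) (hv g)
  | impE Γ A B' _ _ ih₁ ih₂ => exact fun v hv => sat_imp.1 (ih₁ v hv) (ih₂ v hv)
  | falsumE Γ A _ ih =>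
    intro v hv
    by_contra hA
    exact sat_falsum (ih v fun g hg => hg.elim (fun h => h ▸ sat_neg.2 hA) (hv g))
  | allI Γ A _ ih =>
    intro v hv
    rw [sat_all]
    intro x
    refine ih _ ?_
    rintro _ ⟨g, hg, rfl⟩
    rw [Sat, val_lift]
    exact hv g hg
  | allE₂ Γ A t _ ih => exact fun v hv => (subst_iff v A t).2 (sat_all.1 (ih v hv) _)
  | ref Γ t => exact fun v _ => sat_equal.2 rfl
  | subst₂ Γ s t g _ _ ih₁ ih₂ =>
    intro v hv
    rw [subst_iff]
    exact ((ext_val g v).holds_congr (sat_equal.1 (ih₁ v hv))).1 ((subst_iff v g s).1 (ih₂ v hv))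

end BooleanModel

namespace BooleanModel

open FOL SetTheory Name

variable {B : Type} [CompleteBooleanAlgebra B]

/-! ### Satisfaction of the set-theoretic abbreviations -/

section Sat

variable {U : Ult B} {v : ℕ → Name B} {f : Formula LZFC} {s t : Term LZFC} {x y z w : Name B}

@[simp] theorem eval_var (k : ℕ) : eval (&k : Term LZFC) v ![] = v k := rfl

@[simp] theorem eval_emptyT : eval emptyT v ![] = empty := rfl

@[simp] theorem eval_omegaT : eval omegaT v ![] = ordType ℕ := rfl

@[simp] theorem eval_pairT : eval (pairT s t) v ![] = opair (eval s v ![]) (eval t v ![]) := rfl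

@[simp] theorem eval_powersetT : eval (powersetT t) v ![] = power (eval t v ![]) := rfl

@[simp] theorem eval_unionT : eval (unionT t) v ![] = sUnion (eval t v ![]) := rfl

@[simp] theorem eval_up_one : eval (up t 1) (x ∷ v) ![] = eval t v ![] := by
  rw [up, eval_lift]
  rfl

@[simp] theorem eval_up_two : eval (up t 2) (x ∷ y ∷ v) ![] = eval t v ![] := by
  rw [up, eval_lift]
  rfl

@[simp] theorem eval_up_three : eval (up t 3) (x ∷ y ∷ z ∷ v) ![] = eval t v ![] := by
  rw [up, eval_lift]
  rfl

@[simp] theorem sat_allIn :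
    Sat U v (allIn t f) ↔ ∀ x, cls U x ∈ cls U (eval t v ![]) → Sat U (x ∷ v) f := by
  simp [allIn]

@[simp] theorem sat_exIn :
    Sat U v (exIn t f) ↔ ∃ x, cls U x ∈ cls U (eval t v ![]) ∧ Sat U (x ∷ v) f := by
  simp [exIn]

theorem Universe.exists_iff {p : Universe U → Prop} : (∃ m, p m) ↔ ∃ x, p (cls U x) :=
  ⟨fun ⟨m, h⟩ => by obtain ⟨x, rfl⟩ := m.exists_rep; exact ⟨x, h⟩, fun ⟨x, h⟩ => ⟨_, h⟩⟩

instance : HasSubset (Universe U) where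
  Subset a b := ∀ m ∈ a, m ∈ b

theorem Universe.subset_def {a b : Universe U} : a ⊆ b ↔ ∀ m ∈ a, m ∈ b := Iff.rfl

theorem Universe.subset_antisymm {a b : Universe U} (h : a ⊆ b) (h' : b ⊆ a) : a = b :=
  Universe.ext fun m => ⟨h m, h' m⟩

@[simp] theorem sat_subsetF :
    Sat U v (subsetF s t) ↔ cls U (eval s v ![]) ⊆ cls U (eval t v ![]) := by
  simp [subsetF, Universe.subset_def, Universe.forall_iff]

theorem Universe.eq_empty_iff {m : Universe U} : m = cls U empty ↔ ∀ n, n ∉ m :=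
  ⟨fun h => by simp [h], fun h => Universe.ext fun n => by simp [h]⟩

theorem Universe.regularity' {m : Universe U} (hm : m ≠ cls U empty) :
    ∃ n ∈ m, ∀ k ∈ m, k ∉ n := by
  rw [ne_eq, eq_empty_iff] at hm
  push Not at hm
  exact regularity hm.choose_spec

/-- Ordinals of the two-valued quotient. Well-foundedness holds for all sets. -/
def Universe.IsOrd (m : Universe U) : Prop :=
  (∀ a ∈ m, ∀ b ∈ m, a = b ∨ a ∈ b ∨ b ∈ a) ∧ ∀ a ∈ m, a ⊆ m

@[simp] theorem sat_isOrdinal : Sat U v (isOrdinal t) ↔ (cls U (eval t v ![])).IsOrd := by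
  have h : Sat U v (epsilonWellfounded t) := by
    simp only [epsilonWellfounded, sat_all, sat_imp, sat_neg, sat_equal, sat_exIn, sat_allIn, sat_mem,
      eval_var, scons_zero, scons_one, eval_emptyT]
    intro x _ hx
    obtain ⟨n, hn, h⟩ := Universe.regularity' hx
    obtain ⟨y, rfl⟩ := n.exists_rep
    exact ⟨y, hn, fun z => h _⟩
  simp [isOrdinal, h, epsilonTrichotomy, epsilonTransitive, Universe.IsOrd, Universe.forall_iff]

end Sat

/-! ### The axioms of set theory -/

section Axioms

variable {U : Ult B} {v : ℕ → Name B}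

theorem sat_axiomOfEmptyset : Sat U v axiomOfEmptyset.1 := by simp [axiomOfEmptyset]

theorem sat_axiomOfOrderedPairs : Sat U v axiomOfOrderedPairs.1 := by
  simp [axiomOfOrderedPairs, opair_inj]

theorem sat_axiomOfExtensionality : Sat U v axiomOfExtensionality.1 := by
  simp only [axiomOfExtensionality, sat_all, sat_imp, sat_bicond, sat_mem, sat_equal, eval_var,
    scons_zero, scons_one, scons_two]
  exact fun x y h => Universe.ext (Universe.forall_iff.2 h)

theorem sat_axiomOfUnion : Sat U v axiomOfUnion.1 := by
  simp [axiomOfUnion, mem_sUnion, Universe.exists_iff]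

theorem sat_axiomOfPowerset : Sat U v axiomOfPowerset.1 := by
  simp [axiomOfPowerset, mem_power, Universe.forall_iff]

theorem sat_axiomOfRegularity : Sat U v axiomOfRegularity.1 := by
  simp only [axiomOfRegularity, sat_all, sat_imp, sat_neg, sat_equal, sat_exIn, sat_allIn, sat_mem,
    eval_var, scons_zero, scons_one, eval_emptyT]
  intro x hx
  obtain ⟨n, hn, h⟩ := Universe.regularity' hx
  obtain ⟨y, rfl⟩ := n.exists_rep
  exact ⟨y, hn, fun z => h _⟩

theorem sat_alls {f : Formula LZFC} (h : ∀ v : ℕ → Name B, Sat U v f) (n : ℕ) :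
    ∀ v : ℕ → Name B, Sat U v (alls n f) := by
  induction n generalizing f with
  | zero => exact h
  | succ n ih => exact ih fun v => sat_all.2 fun x => h _

/-- Collection for Boolean-valued relations. -/
theorem exists_collection {F : Name B → Name B → B} (h₁ : ∀ y, Ext fun x => F x y)
    (h₂ : ∀ x, Ext (F x)) {A : Name B} (h : ∀ x, cls U x ∈ cls U A → ∃ y, U (F x y)) :
    ∃ C, (∀ x, cls U x ∈ cls U A → ∃ y, cls U y ∈ cls U C ∧ U (F x y)) ∧
      ∀ y, cls U y ∈ cls U C → ∃ x, cls U x ∈ cls U A ∧ U (F x y) := by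
  have hE : Ext fun x => ⨆ y, F x y := fun x x' => by
    rw [inf_iSup_eq]
    exact iSup_mono fun y => h₁ y x x'
  -- The maximum principle gives one best witness per potential element, so the bounding set can be
  -- indexed by `A.Idx`.
  choose g hg using fun i : A.Idx => exists_iSup_le (h₂ (A.el i))
  -- The factor `F (A.el i) (g i)` in the weight ensures that every member of `C` is related to some
  -- member of `A`.
  let C : Name B := mk A.Idx g fun i => A.wt i ⊓ F (A.el i) (g i)
  have hC : ∀ i, A.wt i ⊓ F (A.el i) (g i) ≤ mem (g i) C := fun i => wt_le_mem C i
  refine ⟨C, fun x hx => ?_, fun y hy => ?_⟩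
  · have hle : mem x A ⊓ (⨆ y, F x y) ≤ ⨆ y, mem y C ⊓ F x y := by
      rw [mem, iSup_inf_eq]
      refine iSup_le fun i => le_trans ?_ (le_iSup _ (g i))
      rw [Ult.le_iff]
      intro V hV
      simp only [V.inf] at hV ⊢
      have h3 : V (F (A.el i) (g i)) :=
        V.mono (hg i) ((hE.holds_congr (holds_eq.1 hV.1.2)).1 hV.2)
      exact ⟨V.mono (hC i) (V.inf.2 ⟨hV.1.1, h3⟩),
        ((h₁ _).holds_congr (holds_eq.1 hV.1.2)).2 h3⟩
    obtain ⟨y, hy⟩ := h x hx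
    have := U.mono hle (U.inf.2 ⟨hx, U.mono (le_iSup _ y) hy⟩)
    rw [U.iSup_iff ((ext_mem_left C).inf (h₂ x))] at this
    simpa [holds_mem] using this
  · have hle : mem y C ≤ ⨆ i, A.wt i ⊓ F (A.el i) y := by
      refine iSup_mono fun i => ?_
      rw [Ult.le_iff]
      intro V hV
      simp only [V.inf] at hV ⊢
      have hV' := hV.1
      simp only [C, Name.wt, Name.el, V.inf] at hV'
      exact ⟨hV'.1, ((h₂ _).holds_congr (holds_eq.1 hV.2)).2 hV'.2⟩
    exact (holds_iSup_wt_inf (h₁ y) A).1 (U.mono hle hy)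

theorem sat_axiomOfCollection (n : ℕ) (φ : Formula LZFC) (hφ : φ.BoundedBy (n + 2)) :
    Sat U v (axiomOfCollection n φ hφ).1 := by
  refine sat_alls (fun v => ?_) n v
  have h1 : ∀ y x A : Name B, Sat U (y ∷ x ∷ A ∷ v) (φ.lift 1 2) ↔ Sat U (y ∷ x ∷ v) φ := by
    intro y x A
    rw [Sat, val_lift, Sat]
    congr! 2
    funext k
    match k with
    | 0 => rfl
    | 1 => rfl
    | k + 2 => simp [scons]
  have h2 : ∀ y x C A : Name B, Sat U (y ∷ x ∷ C ∷ A ∷ v) (φ.lift 2 2) ↔ Sat U (y ∷ x ∷ v) φ := by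
    intro y x C A
    rw [Sat, val_lift, Sat]
    congr! 2
    funext k
    match k with
    | 0 => rfl
    | 1 => rfl
    | k + 2 => simp [scons]
  have h3 : ∀ y x C A : Name B,
      Sat U (x ∷ y ∷ C ∷ A ∷ v) ((φ.lift 3 2).subst &1 0) ↔ Sat U (y ∷ x ∷ v) φ := by
    intro y x C A
    rw [Sat, val_subst, val_lift, Sat]
    congr! 2
    funext k
    match k with
    | 0 => rfl
    | 1 => rfl
    | k + 2 => simp [scons, insertVal]
  simp only [sat_all, sat_imp, sat_allIn, sat_ex, sat_conj, sat_exIn, h1, h2, h3, eval_var,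
    scons_zero, scons_one, scons_two]
  intro A h
  refine exists_collection (F := fun x y => val φ (y ∷ x ∷ v) ![]) (fun y => ?_)
    (fun x => ext_val φ _) h
  intro x x'
  refine val_congr φ (fun k => ?_) fun k => k.elim0
  match k with
  | 0 => simp
  | 1 => exact le_rfl
  | k + 2 => simp [scons]

/-- The Boolean value of `x ⊆ y`. -/
noncomputable def Name.sub (x y : Name B) : B := ⨅ i, x.wt i ⇨ mem (x.el i) y

theorem holds_sub {x y : Name B} : U (sub x y) ↔ cls U x ⊆ cls U y := by
  rw [sub, holds_iInf_wt_himp (ext_mem_left y), Universe.subset_def, Universe.forall_iff]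
  rfl

/-- The maximality principle for the two-valued quotient, where the hypothesis is expressed by a Boolean
value `Γ`. -/
theorem exists_maximal {z : Name B} {Γ : B} (hΓ : ∀ V : Ult B, V Γ → ∀ y : Name B,
      cls V y ⊆ cls V z → (∀ a ∈ cls V y, ∀ b ∈ cls V y, a ⊆ b ∨ b ⊆ a) →
      cls V (sUnion y) ∈ cls V z) (hU : U Γ) :
    ∃ m, cls U m ∈ cls U z ∧ ∀ x, cls U x ∈ cls U z → cls U m ⊆ cls U x → cls U m = cls U x := by
  let s : Name B := sUnion z
  have hs : ∀ (V : Ult B) (x : Name B), cls V x ∈ cls V z → cls V x ⊆ cls V s := fun V x hx m hm =>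
    mem_sUnion.2 ⟨_, hx, hm⟩
  -- Members of `z` are subsets of its union `s`, hence coded by weight functions on `s`. These form
  -- a small type, so a chain in it can index a name. Requirements are imposed at every `V`
  -- containing `Γ`, so that `hΓ` applies to the chain.
  let T := {χ : s.Idx → B // ∀ V : Ult B, V Γ → cls V (s.restrict χ) ∈ cls V z}
  let r : T → T → Prop := fun χ χ' =>
    ∀ V : Ult B, V Γ → cls V (s.restrict χ.1) ⊆ cls V (s.restrict χ'.1)
  obtain ⟨m, hm⟩ := exists_maximal_of_chains_bounded (r := r) (by
    intro c hc
    let C : Name B := mk c (fun χ => s.restrict χ.1.1) fun _ => ⊤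
    have hC : ∀ χ ∈ c, ∀ V : Ult B, cls V (s.restrict χ.1) ∈ cls V C := fun χ hχ V =>
      V.mono (wt_le_mem C (⟨χ, hχ⟩ : c)) V.top
    have hCz : ∀ V : Ult B, V Γ → cls V C ⊆ cls V z := by
      intro V hV
      rw [Universe.subset_def, Universe.forall_iff]
      intro x hx
      have : Γ ⊓ mem x C ≤ mem x z := by
        rw [mem, inf_iSup_eq]
        refine iSup_le fun χ => Ult.le_iff.2 fun V hV => ?_
        simp only [V.inf] at hV
        rw [holds_mem, holds_eq.1 hV.2.2]
        exact χ.1.2 V hV.1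
      exact V.mono this (V.inf.2 ⟨hV, hx⟩)
    have hCc : ∀ V : Ult B, V Γ → ∀ a ∈ cls V C, ∀ b ∈ cls V C, a ⊆ b ∨ b ⊆ a := by
      intro V hV
      simp only [Universe.forall_iff]
      intro x hx y hy
      have : Γ ⊓ (mem x C ⊓ mem y C) ≤ sub x y ⊔ sub y x := by
        simp only [mem, iSup_inf_eq, inf_iSup_eq]
        refine iSup_le fun χ => iSup_le fun χ' => Ult.le_iff.2 fun V hV => ?_
        simp only [V.inf] at hV
        rw [V.sup, holds_sub, holds_sub, holds_eq.1 hV.2.1.2, holds_eq.1 hV.2.2.2]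
        by_cases hχ : χ.1 = χ'.1
        · obtain rfl : χ = χ' := Subtype.ext hχ
          exact Or.inl fun a ha => ha
        · exact (hc χ.2 χ'.2 hχ).symm.imp (fun h => h V hV.1) (fun h => h V hV.1)
      simpa [holds_sub] using V.mono this (V.inf.2 ⟨hV, V.inf.2 ⟨hx, hy⟩⟩)
    have hu : ∀ V : Ult B, V Γ → cls V (s.restrict fun i => mem (s.el i) (sUnion C)) =
        cls V (sUnion C) := fun V hV =>
      cls_restrict_mem (hs V _ (hΓ V hV C (hCz V hV) (hCc V hV)))
    refine ⟨⟨fun i => mem (s.el i) (sUnion C), fun V hV => ?_⟩, fun χ hχ V hV => ?_⟩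
    · rw [hu V hV]
      exact hΓ V hV C (hCz V hV) (hCc V hV)
    · dsimp only
      rw [hu V hV]
      exact fun a ha => mem_sUnion.2 ⟨_, hC χ hχ V, ha⟩)
    (fun h h' V hV a ha => h' V hV a (h V hV a ha))
  refine ⟨s.restrict m.1, m.2 U hU, fun x hx hmx => ?_⟩
  let M : Name B := s.restrict m.1
  let Q : B := mem x z ⊓ sub M x
  -- Maximality of `m` concerns all `V` containing `Γ`, whereas `x` extends `M` only modulo `U`. So
  -- `N` is built to equal `x` where `Q` holds and `M` elsewhere.
  let F : Name B → B := fun w => (mem w M)ᶜ ⇨ Q ⊓ mem w x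
  have hF : Ext F := (ext_mem_left M).compl.himp ((Ext.const Q).inf (ext_mem_left x))
  let N : Name B := s.restrict fun i => F (s.el i)
  have hN : ∀ (V : Ult B) w, cls V w ∈ cls V N ↔
      cls V w ∈ cls V s ∧ (cls V w ∈ cls V M ∨ V Q ∧ cls V w ∈ cls V x) := by
    intro V w
    rw [mem_restrict hF, V.himp, V.compl, V.inf, holds_mem, holds_mem, or_iff_not_imp_left]
  have hMN : ∀ V : Ult B, cls V M ⊆ cls V N := by
    intro V
    rw [Universe.subset_def, Universe.forall_iff]
    exact fun w hw => (hN V w).2 ⟨restrict_subset hw, Or.inl hw⟩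
  have hNx : ∀ V : Ult B, V Q → cls V N = cls V x := by
    intro V hV
    have hV' : cls V x ∈ cls V z ∧ cls V M ⊆ cls V x := by
      rw [← holds_sub, ← holds_mem]
      exact V.inf.1 hV
    refine Universe.ext (Universe.forall_iff.2 fun w => ?_)
    rw [hN]
    exact ⟨fun h => h.2.elim (hV'.2 _) And.right, fun h => ⟨hs V x hV'.1 _ h, Or.inr ⟨hV, h⟩⟩⟩
  have hNM : ∀ V : Ult B, ¬ V Q → cls V N = cls V M := by
    intro V hV
    refine Universe.subset_antisymm ?_ (hMN V)
    rw [Universe.subset_def, Universe.forall_iff]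
    exact fun w hw => ((hN V w).1 hw).2.resolve_right fun h => hV h.1
  have hNT : ∀ V : Ult B, V Γ → cls V N ∈ cls V z := by
    intro V hV
    by_cases hQ : V Q
    · rw [hNx V hQ]
      exact (V.inf.1 hQ).1
    · rw [hNM V hQ]
      exact m.2 V hV
  have hQ : U Q := U.inf.2 ⟨hx, holds_sub.2 hmx⟩
  refine Universe.subset_antisymm hmx ?_
  rw [← hNx U hQ]
  exact hm ⟨fun i => F (s.el i), hNT⟩ (fun V _ => hMN V) U hU

theorem sat_zornsLemma : Sat U v zornsLemma.1 := by
  rw [zornsLemma, sat_all]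
  intro z
  rw [sat_imp, sat_imp]
  intro _ h
  have key := exists_maximal (U := U) (z := z) (fun V (hV : Sat V (z ∷ v) _) => ?_) h
  · simpa using key
  · intro y
    have := sat_all.1 hV y
    simpa [Universe.forall_iff] using this

end Axioms

end BooleanModel

namespace BooleanModel

open FOL SetTheory Name

variable {B : Type} [CompleteBooleanAlgebra B] {U : Ult B} {v : ℕ → Name B}

/-! ### Ordinals -/

/-- To prove a Boolean-valued statement about an element of `A`, one may assume that the element is
one of the potential elements, at the cost of changing the ultrafilter. -/
theorem holds_of_mem {Γ b : B} {x A : Name B} (hΓ : U Γ) (hx : cls U x ∈ cls U A)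
    (h : ∀ (i : A.Idx) (V : Ult B), V Γ → V (A.wt i) → cls V x = cls V (A.el i) → V b) : U b := by
  have : Γ ⊓ mem x A ≤ b := by
    rw [mem, inf_iSup_eq]
    refine iSup_le fun i => Ult.le_iff.2 fun V hV => ?_
    simp only [V.inf] at hV
    exact h i V hV.1 hV.2.1 (holds_eq.1 hV.2.2)
  exact U.mono this (U.inf.2 ⟨hΓ, hx⟩)

theorem cls_el_mem {A : Name B} {i : A.Idx} (h : U (A.wt i)) : cls U (A.el i) ∈ cls U A :=
  U.mono (wt_le_mem A i) h

namespace Universe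

theorem notMem_self (a : Universe U) : a ∉ a := by
  obtain ⟨x, rfl⟩ := a.exists_rep
  intro h
  obtain ⟨n, hn, h'⟩ := regularity (a := cls U (upair x x)) (mem_upair.2 (Or.inl rfl))
  rw [mem_upair, or_self] at hn
  exact h' _ (mem_upair.2 (Or.inl rfl)) (hn ▸ h)

theorem notMem_of_mem {a b : Universe U} (h : a ∈ b) : b ∉ a := by
  obtain ⟨x, rfl⟩ := a.exists_rep
  obtain ⟨y, rfl⟩ := b.exists_rep
  intro h'
  obtain ⟨n, hn, hmin⟩ := regularity (a := cls U (upair x y)) (mem_upair.2 (Or.inl rfl))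
  rcases mem_upair.1 hn with rfl | rfl
  · exact hmin _ (mem_upair.2 (Or.inr rfl)) h'
  · exact hmin _ (mem_upair.2 (Or.inl rfl)) h

/-- A proper transitive subset `c` of `a` equals any `∈`-minimal element of `a \ c`. -/
theorem IsOrd.mem_of_subset {a c : Universe U} (ha : a.IsOrd) (hca : c ⊆ a)
    (hc : ∀ m ∈ c, m ⊆ c) (hne : c ≠ a) : c ∈ a := by
  obtain ⟨d, hd⟩ := exists_diff a c
  have : ∃ m, m ∈ d := by
    by_contra! h
    refine hne (subset_antisymm hca fun m hm => ?_)
    by_contra hmc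
    exact h m ((hd m).2 ⟨hm, hmc⟩)
  obtain ⟨m, hm, hmin⟩ := regularity this.choose_spec
  rw [hd] at hm
  have : c = m := by
    refine subset_antisymm (fun k hk => ?_) (fun k hk => ?_)
    · rcases ha.1 k (hca k hk) m hm.1 with rfl | h | h
      · exact absurd hk hm.2
      · exact h
      · exact absurd (hc k hk m h) hm.2
    · by_contra hkc
      exact hmin k ((hd k).2 ⟨ha.2 m hm.1 k hk, hkc⟩) hk
  exact this ▸ hm.1

/-- If the intersection were proper in both ordinals, it would belong to both, hence to itself. -/
theorem IsOrd.subset_or_mem {a b : Universe U} (ha : a.IsOrd) (hb : b.IsOrd) : a ⊆ b ∨ b ∈ a := by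
  obtain ⟨c, hc⟩ := exists_inter a b
  have hct : ∀ m ∈ c, m ⊆ c := fun m hm k hk =>
    (hc k).2 ⟨ha.2 m ((hc m).1 hm).1 k hk, hb.2 m ((hc m).1 hm).2 k hk⟩
  by_cases h1 : c = a
  · exact Or.inl fun m hm => ((hc m).1 (h1 ▸ hm)).2
  have h2 : c ∈ a := ha.mem_of_subset (fun m hm => ((hc m).1 hm).1) hct h1
  by_cases h3 : c = b
  · exact Or.inr (h3 ▸ h2)
  exact absurd ((hc c).2 ⟨h2, hb.mem_of_subset (fun m hm => ((hc m).1 hm).2) hct h3⟩)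
    (notMem_self c)

end Universe

/-! ### Canonical names of ordinals -/

section WellOrder

variable {W : Type} [LinearOrder W] [WellFoundedLT W]

theorem ord_mem_ord {w w' : W} (h : w < w') : cls U (ord w) ∈ cls U (ord w') := by
  rw [ord_eq w']
  exact cls_el_mem (A := mk {v : W // v < w'} (fun v => ord v.1) fun _ => ⊤) (i := ⟨w, h⟩) U.top

theorem ord_mem_ordType (w : W) : cls U (ord w) ∈ cls U (ordType W) :=
  cls_el_mem (A := ordType W) (i := w) U.top

theorem holds_of_mem_ordType {Γ b : B} {x : Name B} (hΓ : U Γ) (hx : cls U x ∈ cls U (ordType W))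
    (h : ∀ (w : W) (V : Ult B), V Γ → cls V x = cls V (ord w) → V b) : U b :=
  holds_of_mem hΓ hx fun w V hV _ hx => h w V hV hx

theorem holds_of_mem_ord {Γ b : B} {x : Name B} {w : W} (hΓ : U Γ) (hx : cls U x ∈ cls U (ord w))
    (h : ∀ w' < w, ∀ V : Ult B, V Γ → cls V x = cls V (ord w') → V b) : U b := by
  rw [ord_eq w] at hx
  exact holds_of_mem hΓ hx fun w' V hV _ hx => h w'.1 w'.2 V hV hx

theorem ord_eq_ord_iff {w w' : W} : cls U (ord w) = cls U (ord w') ↔ w = w' := by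
  refine ⟨fun h => ?_, fun h => h ▸ rfl⟩
  by_contra hne
  rcases lt_or_gt_of_ne hne with h' | h'
  · have := ord_mem_ord (U := U) h'
    rw [h] at this
    exact Universe.notMem_self _ this
  · have := ord_mem_ord (U := U) h'
    rw [h] at this
    exact Universe.notMem_self _ this

/-- Names of initial segments of well-orders denote ordinals. -/
theorem isOrd_of_initial {I : Type} {g : I → W} (hg : ∀ i, ∀ w < g i, ∃ j, g j = w) :
    (cls U (mk I (fun i => ord (g i)) fun _ => (⊤ : B))).IsOrd := by
  set A : Name B := mk I (fun i => ord (g i)) fun _ => (⊤ : B)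
  have hA : ∀ (V : Ult B) i, cls V (ord (g i)) ∈ cls V A := fun V i =>
    cls_el_mem (A := A) (i := i) V.top
  simp only [Universe.IsOrd, Universe.forall_iff]
  constructor
  · intro x hx y hy
    have : U (eq x y ⊔ (mem x y ⊔ mem y x)) := by
      -- `Γ` carries the facts that must survive the change of ultrafilter: first `y ∈ A`, then the
      -- identification of `x`.
      refine holds_of_mem (Γ := mem y A) hy hx fun (i : I) V hV _ hx => ?_
      refine holds_of_mem (Γ := eq x (ord (g i))) (holds_eq.2 hx) hV fun (j : I) V hV _ hy => ?_
      rw [holds_eq] at hV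
      replace hy : cls V y = cls V (ord (g j)) := hy
      simp only [V.sup, holds_eq, holds_mem, hV, hy]
      rcases lt_trichotomy (g i) (g j) with h | h | h
      · exact Or.inr (Or.inl (ord_mem_ord h))
      · exact Or.inl (h ▸ rfl)
      · exact Or.inr (Or.inr (ord_mem_ord h))
    simpa only [U.sup, holds_eq, holds_mem] using this
  · intro x hx
    rw [← holds_sub]
    refine holds_of_mem (Γ := ⊤) U.top hx fun (i : I) V _ _ hx => ?_
    rw [holds_sub, hx, Universe.subset_def, Universe.forall_iff]
    intro y hy
    rw [← holds_mem]
    refine holds_of_mem_ord (Γ := ⊤) (w := g i) V.top hy fun w hw V _ hy => ?_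
    rw [holds_mem, hy]
    obtain ⟨j, rfl⟩ := hg i w hw
    exact hA V j

theorem isOrd_ord (w : W) : (cls U (ord w)).IsOrd := by
  rw [ord_eq w]
  exact isOrd_of_initial fun i w' hw' => ⟨⟨w', hw'.trans i.2⟩, rfl⟩

theorem isOrd_ordType : (cls U (ordType W)).IsOrd :=
  isOrd_of_initial (g := id) fun _ w _ => ⟨w, rfl⟩

end WellOrder

theorem ord_zero : cls U (ord (0 : ℕ)) = cls U empty := by
  rw [Universe.eq_empty_iff, Universe.forall_iff]
  intro x hx
  exact U.bot (holds_of_mem_ord (Γ := ⊤) U.top hx fun n hn => absurd hn (Nat.not_lt_zero n))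

theorem ord_mem_of_limit {α : Universe U} (hα : α.IsOrd) (h0 : cls U empty ∈ α)
    (hs : ∀ m ∈ α, ∃ n ∈ α, m ∈ n) (n : ℕ) : cls U (ord n) ∈ α := by
  induction n with
  | zero => rwa [ord_zero]
  | succ n ih =>
    -- Otherwise `α` is included in `n + 1`, so a `k ∈ α` above `n` would be equal to `n` or an
    -- element of it.
    refine (hα.subset_or_mem (isOrd_ord (n + 1))).resolve_left fun hsub => ?_
    obtain ⟨k, hk, hnk⟩ := hs _ ih
    obtain ⟨x, rfl⟩ := k.exists_rep
    have : U (eq x (ord n) ⊔ mem x (ord n)) := by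
      refine holds_of_mem_ord (Γ := ⊤) U.top (hsub _ hk) fun m hm V _ hx => ?_
      simp only [V.sup, holds_eq, holds_mem, hx]
      rcases (Nat.le_of_lt_succ hm).eq_or_lt with rfl | h
      · exact Or.inl rfl
      · exact Or.inr (ord_mem_ord h)
    simp only [U.sup, holds_eq, holds_mem] at this
    rcases this with h | h
    · exact Universe.notMem_self _ (h ▸ hnk)
    · exact Universe.notMem_of_mem hnk h

theorem sat_axiomOfInfinity : Sat U v axiomOfInfinity.1 := by
  rw [axiomOfInfinity, sat_conj, sat_conj, sat_conj]
  refine ⟨?_, ?_, ?_, ?_⟩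
  · simp only [sat_mem, eval_emptyT, eval_omegaT, ← ord_zero]
    exact ord_mem_ordType _
  · rw [sat_allIn]
    intro x hx
    refine holds_of_mem_ordType (Γ := ⊤) U.top hx fun n V _ hx => (?_ : Sat V _ _)
    simp only [sat_exIn, sat_mem, eval_var, scons_zero, scons_one, eval_omegaT, hx]
    exact ⟨ord (n + 1), ord_mem_ordType _, ord_mem_ord n.lt_succ_self⟩
  · rw [sat_ex]
    exact ⟨ordType ℕ, by simpa using isOrd_ordType⟩
  · rw [sat_all]
    intro α
    rw [sat_imp, sat_imp]
    intro h1 h2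
    simp only [sat_subsetF, eval_omegaT, eval_var, scons_zero, Universe.subset_def,
      Universe.forall_iff]
    intro x hx
    rw [← holds_mem]
    refine holds_of_mem_ordType (U.inf.2 ⟨h1, h2⟩) hx fun n V hV hx => ?_
    rw [holds_mem, hx]
    obtain ⟨h1 : Sat V _ _, h2 : Sat V _ _⟩ := V.inf.1 hV
    simp only [sat_isOrdinal, sat_conj, sat_mem, sat_allIn, sat_exIn, eval_var, scons_zero, scons_one,
      eval_emptyT] at h1 h2
    refine ord_mem_of_limit h1 h2.1 ?_ n
    simpa only [Universe.forall_iff, Universe.exists_iff] using h2.2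

/-- The quotient of a Boolean-valued universe by an ultrafilter is a model of set theory. -/
theorem sat_of_mem_ZFC {f : Sentence LZFC} (hf : f ∈ ZFC) : Sat U v f.1 := by
  rcases hf with hf | ⟨n, φ, hφ, rfl⟩
  · simp only [Set.mem_insert_iff, Set.mem_singleton_iff] at hf
    rcases hf with rfl | rfl | rfl | rfl | rfl | rfl | rfl | rfl
    · exact sat_axiomOfEmptyset
    · exact sat_axiomOfOrderedPairs
    · exact sat_axiomOfExtensionality
    · exact sat_axiomOfUnion
    · exact sat_axiomOfPowerset
    · exact sat_axiomOfInfinity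
    · exact sat_axiomOfRegularity
    · exact sat_zornsLemma
  · exact sat_axiomOfCollection n φ hφ

theorem sat_of_proves (U : Ult B) (v : ℕ → Name B) {f : Sentence LZFC} (h : Theory.Proves ZFC f) :
    Sat U v f.1 := by
  obtain ⟨h⟩ := h
  refine sound U h v ?_
  rintro _ ⟨g, hg, rfl⟩
  exact sat_of_mem_ZFC hg

/-! ### Cardinality comparison -/

/-- In the quotient by `U`, some subset of `Y` surjects onto `X`. -/
def Leq (U : Ult B) (X Y : Name B) : Prop :=
  ∃ S, cls U S ⊆ cls U Y ∧ ∃ f,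
    (∀ p, cls U p ∈ cls U f → ∃ s, cls U s ∈ cls U S ∧ ∃ x, cls U x ∈ cls U X ∧
      cls U p = cls U (opair s x)) ∧
    (∀ s, cls U s ∈ cls U S → ∃ x, cls U x ∈ cls U X ∧ cls U (opair s x) ∈ cls U f) ∧
    (∀ s x y, cls U (opair s x) ∈ cls U f → cls U (opair s y) ∈ cls U f → cls U x = cls U y) ∧
    ∀ x, cls U x ∈ cls U X → ∃ s, cls U s ∈ cls U S ∧ cls U (opair s x) ∈ cls U f

@[simp] theorem sat_leqF {s t : Term LZFC} :
    Sat U v (leqF s t) ↔ Leq U (eval s v ![]) (eval t v ![]) := by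
  simp [leqF, isSurjection, isFunction, Leq, and_assoc]

theorem sat_CH : Sat U v CH.1 ↔
    ∀ x, (cls U x).IsOrd → Leq U x (ordType ℕ) ∨ Leq U (power (ordType ℕ)) x := by
  simp [CH]

/-- The graph is the name of the pairs `(s i, x i)` with weights `b i`. Single-valuedness is
required at every `V`, since elements of the graph modulo `U` become potential elements only after
passing to some `V`. -/
theorem leq_of_family {I : Type} {s x : I → Name B} {b : I → B} {X Y : Name B}
    (h : ∀ (V : Ult B) i j, V (b i) → V (b j) → cls V (s i) = cls V (s j) →
      cls V (x i) = cls V (x j))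
    (hY : cls U (mk I s b) ⊆ cls U Y) (hX : cls U X = cls U (mk I x b)) : Leq U X Y := by
  let f : Name B := mk I (fun i => opair (s i) (x i)) b
  let S : Name B := mk I s b
  let R : Name B := mk I x b
  have hf : ∀ (V : Ult B) i, V (b i) → cls V (opair (s i) (x i)) ∈ cls V f := fun V i hi =>
    cls_el_mem (A := f) (i := i) hi
  have hS : ∀ (V : Ult B) i, V (b i) → cls V (s i) ∈ cls V S := fun V i hi =>
    cls_el_mem (A := S) (i := i) hi
  have hR : ∀ (V : Ult B) i, V (b i) → cls V (x i) ∈ cls V R := fun V i hi =>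
    cls_el_mem (A := R) (i := i) hi
  have hXR : ∀ a, a ∈ cls U X ↔ a ∈ cls U R := fun a => by rw [hX]
  refine ⟨S, hY, f, fun p hp => ?_, fun a ha => ?_, fun a y z hy hz => ?_, fun y hy => ?_⟩
  · have : Sat U (p ∷ S ∷ R ∷ fun _ => empty) (exIn &1 (exIn &3 (&2 ≐ pairT &1 &0))) := by
      refine holds_of_mem (Γ := ⊤) U.top hp fun (i : I) V _ hi hp => (?_ : Sat V _ _)
      simp only [sat_exIn, sat_equal, eval_pairT, eval_var, scons_zero, scons_one, scons_two,
        scons_three]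
      exact ⟨s i, hS V i hi, x i, hR V i hi, hp⟩
    simpa [hXR] using this
  · have : Sat U (a ∷ f ∷ R ∷ fun _ => empty) (exIn &2 (pairT &1 &0 ∊ &2)) := by
      refine holds_of_mem (Γ := ⊤) U.top ha fun (i : I) V _ hi ha => (?_ : Sat V _ _)
      simp only [sat_exIn, sat_mem, eval_pairT, eval_var, scons_zero, scons_one, scons_two]
      exact ⟨x i, hR V i hi, by rw [opair_inj.2 ⟨ha, rfl⟩]; exact hf V i hi⟩
    simpa [hXR] using this
  · rw [← holds_eq]
    refine holds_of_mem (Γ := mem (opair a z) f) hz hy fun (i : I) V hV hi hy => ?_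
    have hΓ : V (b i ⊓ eq (opair a y) (opair (s i) (x i))) := V.inf.2 ⟨hi, holds_eq.2 hy⟩
    refine holds_of_mem hΓ hV fun (j : I) V hV hj hz => ?_
    rw [V.inf, holds_eq, opair_inj] at hV
    replace hz := opair_inj.1 (show cls V (opair a z) = cls V (opair (s j) (x j)) from hz)
    rw [holds_eq, hV.2.2, hz.2]
    exact h V i j hV.1 hj (hV.2.1.symm.trans hz.1)
  · rw [hXR] at hy
    have : Sat U (y ∷ f ∷ S ∷ fun _ => empty) (exIn &2 (pairT &0 &1 ∊ &2)) := by
      refine holds_of_mem (Γ := ⊤) U.top hy fun (i : I) V _ hi hy => (?_ : Sat V _ _)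
      simp only [sat_exIn, sat_mem, eval_pairT, eval_var, scons_zero, scons_one, scons_two]
      exact ⟨s i, hS V i hi, by rw [opair_inj.2 ⟨rfl, hy⟩]; exact hf V i hi⟩
    simpa using this

end BooleanModel

namespace BooleanModel

open FOL SetTheory Name

/-! ### Complete Boolean algebras of regular elements -/

/-- The double complement `toRegular` is left adjoint to the inclusion, so it carries joins and
meets of the frame to joins and meets of regular elements. -/
noncomputable instance regularCompleteBooleanAlgebra {α : Type*} [Order.Frame α] :
    CompleteBooleanAlgebra (Heyting.Regular α) where
  __ := (inferInstance : BooleanAlgebra (Heyting.Regular α))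
  sSup s := Heyting.Regular.toRegular (sSup (Heyting.Regular.val '' s))
  sInf s := Heyting.Regular.toRegular (sInf (Heyting.Regular.val '' s))
  isLUB_sSup s := by
    refine ⟨fun b hb => ?_, fun c hc => Heyting.Regular.gi.gc.l_le (sSup_le ?_)⟩
    · rw [← Heyting.Regular.toRegular_coe b]
      exact Heyting.Regular.toRegular.monotone (le_sSup ⟨b, hb, rfl⟩)
    · rintro _ ⟨b, hb, rfl⟩
      exact hc hb
  isGLB_sInf s := by
    refine ⟨fun b hb => Heyting.Regular.gi.gc.l_le (sInf_le ⟨b, hb, rfl⟩), fun c hc => ?_⟩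
    rw [← Heyting.Regular.toRegular_coe c]
    refine Heyting.Regular.toRegular.monotone (le_sInf ?_)
    rintro _ ⟨b, hb, rfl⟩
    exact hc hb

/-! ### The first uncountable well-order -/

/-- The well-order of type `ω₁`. -/
abbrev Omega1 : Type := (Cardinal.aleph 1).ord.ToType

instance : Uncountable Omega1 := by
  rw [← Cardinal.aleph0_lt_mk_iff, Cardinal.mk_ord_toType]
  exact Cardinal.aleph0_lt_aleph_one

instance (w : Omega1) : Countable {v // v < w} := by
  have := Cardinal.mk_Iio_lt w (by simp)
  rw [Cardinal.mk_ord_toType, Cardinal.lt_aleph_one_iff, Cardinal.mk_le_aleph0_iff] at this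
  exact this

/-- `Omega1 × ℕ` has the size of `Omega1`, so Cantor's theorem applies. This is why P(ω₁) serves to
index the new reals. -/
theorem not_injective_set_omega1 (f : Set Omega1 → Omega1 × ℕ) : ¬ Function.Injective f := by
  intro hf
  have h : Cardinal.mk (Omega1 × ℕ) = Cardinal.mk Omega1 := by
    simp [Cardinal.aleph0_le_aleph]
  obtain ⟨e⟩ := Cardinal.eq.1 h
  exact Function.cantor_injective _ (e.injective.comp hf)

/-! ### The countable chain condition -/

section CCC

variable {B : Type} [CompleteBooleanAlgebra B] {U : Ult B}

/-- The countable chain condition. -/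
def CCC (B : Type) [CompleteBooleanAlgebra B] : Prop :=
  ∀ (J : Type) (c : J → B), (∀ j, c j ≠ ⊥) → (Pairwise fun i j => c i ⊓ c j = ⊥) → Countable J

/-- Under the countable chain condition, surjections from a set with few potential elements onto a
set with many distinct elements do not exist. -/
theorem not_leq_of_ccc (hB : CCC B) {I K : Type} (hK : ∀ f : K → I × ℕ, ¬ Function.Injective f)
    {y : I → Name B} {wt : I → B} {X : Name B} {c : K → Name B}
    (hc : ∀ (V : Ult B) k k', cls V (c k) = cls V (c k') → k = k')
    (hX : ∀ (V : Ult B) k, cls V (c k) ∈ cls V X) : ¬ Leq U X (mk I y wt) := by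
  rintro ⟨S, hS, f, -, -, hfun, hsurj⟩
  let Y : Name B := mk I y wt
  let φ : Formula LZFC := subsetF &1 &3 ⋏
    FOL.all (FOL.all (FOL.all (pairT &2 &1 ∊ &3 ⟹ pairT &2 &0 ∊ &3 ⟹ &1 ≐ &0))) ⋏
    allIn &2 (exIn &2 (pairT &0 &1 ∊ &2))
  let Γ : B := val φ (f ∷ S ∷ X ∷ Y ∷ fun _ => empty) ![]
  have hφ : ∀ V : Ult B, V Γ ↔ cls V S ⊆ cls V Y ∧
      (∀ s x y, cls V (opair s x) ∈ cls V f → cls V (opair s y) ∈ cls V f → cls V x = cls V y) ∧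
      ∀ x, cls V x ∈ cls V X → ∃ s, cls V s ∈ cls V S ∧ cls V (opair s x) ∈ cls V f := by
    intro V
    change Sat V _ φ ↔ _
    simp [φ]
  have hΓ : U Γ := (hφ U).2 ⟨hS, hfun, hsurj⟩
  -- `d i k` is the value of "`f` is as required and sends `y i` to `c k`". For each `k` some `d i
  -- k` is nonzero, as `Γ` is.
  let d : I → K → B := fun i k => Γ ⊓ mem (opair (y i) (c k)) f
  have h1 : ∀ k, ∃ i, d i k ≠ ⊥ := by
    intro k
    by_contra! h
    have h2 : Γ ≤ ⨆ i, mem (opair (y i) (c k)) f := by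
      rw [Ult.le_iff]
      intro V hV
      obtain ⟨hS, -, hsurj⟩ := (hφ V).1 hV
      obtain ⟨s, hs, hsf⟩ := hsurj _ (hX V k)
      refine holds_of_mem (Γ := mem (opair s (c k)) f) hsf (hS _ hs) fun (i : I) V hV _ hs => ?_
      refine V.mono (le_iSup _ i) ?_
      rw [holds_mem] at hV ⊢
      rwa [← opair_inj.2 ⟨show cls V s = cls V (y i) from hs, rfl⟩]
    have h3 : Γ = ⊥ := by
      rw [← inf_eq_left.2 h2, inf_iSup_eq]
      simpa using h
    exact U.bot (h3 ▸ hΓ)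
  choose g hg using h1
  -- For fixed `i` the values `d i k` are disjoint, since `f` is single-valued; the chain condition
  -- makes each fibre of `g` countable, and numbering the fibres injects `K` into `I × ℕ`.
  have h2 : ∀ i, Countable {k // g k = i} := by
    intro i
    refine hB _ (fun k => d i k.1) (fun k => by have := hg k.1; rwa [k.2] at this) ?_
    intro k k' hkk'
    rw [← le_bot_iff, Ult.le_iff]
    intro V hV
    simp only [d, V.inf] at hV
    exact absurd (Subtype.ext (hc V _ _ (((hφ V).1 hV.1.1).2.1 _ _ _ hV.1.2 hV.2.2))) hkk'
  choose e he using fun i => (h2 i).exists_injective_nat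
  refine hK (fun k => (g k, e (g k) ⟨k, rfl⟩)) fun k k' h => ?_
  obtain ⟨h3, h4⟩ := Prod.mk.inj h
  have h5 : ∀ i i' (p : {k // g k = i}) (p' : {k // g k = i'}), i = i' → e i p = e i' p' →
      p.1 = p'.1 := by
    rintro i _ p p' rfl h
    exact congrArg _ (he i h)
  exact h5 _ _ _ _ h3 h4

/-- The real with `B`-valued characteristic function `a`. -/
noncomputable def Name.real (a : ℕ → B) : Name B := mk ℕ ord a

theorem real_subset {a : ℕ → B} : cls U (real a) ⊆ cls U (ordType ℕ) := by
  rw [← holds_sub]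
  refine Ult.mono U (le_iInf fun (n : ℕ) => ?_) U.top
  rw [Ult.le_iff]
  intro V _
  rw [V.himp]
  exact fun _ => ord_mem_ordType n

theorem ord_mem_real {a : ℕ → B} {n : ℕ} : cls U (ord n) ∈ cls U (real a) ↔ U (a n) := by
  refine ⟨fun h => ?_, fun h => cls_el_mem (A := real a) (i := n) h⟩
  refine holds_of_mem (Γ := ⊤) U.top h fun (m : ℕ) V _ hm h => ?_
  rw [ord_eq_ord_iff.1 h]
  exact hm

/-- Adding many reals by an algebra with the countable chain condition refutes the continuum
hypothesis. -/
theorem not_sat_CH (hB : CCC B) (a : Set Omega1 → ℕ → B)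
    (ha : ∀ k k', k ≠ k' → ∀ b : B, (∀ n, b ⊓ a k n ≤ a k' n) → b = ⊥) (v : ℕ → Name B) :
    ¬ Sat U v CH.1 := by
  rw [sat_CH]
  intro h
  rcases h (ordType Omega1) isOrd_ordType with h | h
  · refine not_leq_of_ccc hB (fun f hf => ?_) (c := ord) (fun V k k' => ord_eq_ord_iff.1)
      (fun V => ord_mem_ordType) h
    exact not_countable (α := Omega1) hf.countable
  · refine not_leq_of_ccc hB not_injective_set_omega1 (c := fun k => real (a k)) (fun V k k' h => ?_)
      (fun V k => mem_power.2 real_subset) h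
    by_contra hne
    have h1 := ha k k' hne (eq (real (a k)) (real (a k'))) fun n => by
      rw [Ult.le_iff]
      intro V hV
      rw [V.inf, holds_eq, ← ord_mem_real] at hV
      rw [← ord_mem_real, ← hV.1]
      exact hV.2
    rw [← holds_eq, h1] at h
    exact V.bot h

end CCC

/-! ### The Cohen algebra -/

section Cohen

variable {I : Type}

open TopologicalSpace MeasureTheory

/-- The algebra of regular open subsets of `2^I`. -/
abbrev Cohen (I : Type) : Type := Heyting.Regular (Opens (I → Bool))

/-- The uniform product measure on `2^I`. -/
noncomputable def coinMeasure (I : Type) : Measure (I → Bool) :=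
  Measure.infinitePi fun _ => (PMF.uniformOfFintype Bool).toMeasure

instance : IsProbabilityMeasure (coinMeasure I) := by
  unfold coinMeasure
  infer_instance

theorem exists_cylinder_subset {s : Set (I → Bool)} (hs : IsOpen s) {x : I → Bool} (hx : x ∈ s) :
    ∃ F : Finset I, (F : Set I).pi (fun i => {x i}) ⊆ s := by
  obtain ⟨F, u, hu, hF⟩ := isOpen_pi_iff.1 hs x hx
  exact ⟨F, fun y hy => hF fun i hi => by rw [hy i hi]; exact (hu i hi).2⟩

theorem coinMeasure_cylinder_pos (F : Finset I) (x : I → Bool) :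
    0 < coinMeasure I ((F : Set I).pi fun i => {x i}) := by
  rw [coinMeasure, Measure.infinitePi_pi _ fun i _ => MeasurableSet.singleton _, pos_iff_ne_zero,
    Finset.prod_ne_zero_iff]
  intro i _
  rw [PMF.toMeasure_apply_singleton _ _ (MeasurableSet.singleton _)]
  simp

theorem Cohen.exists_mem {b : Cohen I} (hb : b ≠ ⊥) : ∃ x, x ∈ b.val := by
  by_contra! h
  refine hb (Heyting.Regular.coe_injective (Opens.ext (Set.eq_empty_iff_forall_notMem.2 h)))

/-- Each nonzero element contains a cylinder of positive measure, and a probability space has only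
countably many disjoint sets of positive measure. -/
theorem ccc_cohen : CCC (Cohen I) := by
  intro J c hc hd
  choose x hx using fun j => Cohen.exists_mem (hc j)
  choose F hF using fun j => exists_cylinder_subset (c j).val.isOpen (hx j)
  have h := Measure.countable_meas_pos_of_disjoint_iUnion (μ := coinMeasure I)
    (As := fun j => (F j : Set I).pi fun i => {x j i})
    (fun j => MeasurableSet.pi (F j).countable_toSet fun i _ => MeasurableSet.singleton _)
    (fun j k hjk => by
      rw [Function.onFun, Set.disjoint_left]
      intro z hz hz'
      have h1 : z ∈ (c j ⊓ c k).val := ⟨hF j hz, hF k hz'⟩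
      rw [show c j ⊓ c k = ⊥ from hd hjk] at h1
      exact h1)
  simp only [coinMeasure_cylinder_pos] at h
  exact Set.countable_univ_iff.1 (by simpa using h)

/-- The set of sequences with a given bit. -/
def bitOpens (i : I) (c : Bool) : Opens (I → Bool) :=
  ⟨{x | x i = c}, (isOpen_discrete ({c} : Set Bool)).preimage
    (continuous_apply (A := fun _ : I => Bool) i)⟩

theorem bitOpens_compl (i : I) (c : Bool) : (bitOpens i c)ᶜ = bitOpens i (!c) := by
  refine IsCompl.compl_eq (IsCompl.of_eq ?_ ?_)
  · refine Opens.ext (Set.eq_empty_iff_forall_notMem.2 fun x hx => ?_)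
    have h1 : x i = c := hx.1
    have h2 : x i = !c := hx.2
    simp [h1] at h2
  · refine Opens.ext (Set.eq_univ_of_forall fun x => ?_)
    have h : x i = c ∨ x i = !c := by cases c <;> simp
    exact h

/-- The Boolean value of the generic bit `i`. -/
def Cohen.bit (i : I) : Cohen I :=
  ⟨bitOpens i true, by simp [Heyting.IsRegular, bitOpens_compl]⟩

theorem Cohen.mem_bit {i : I} {x : I → Bool} : x ∈ (Cohen.bit i).val ↔ x i = true := Iff.rfl

/-- A cylinder inside `b` constrains finitely many coordinates. At a fresh `n`, bit `(k, n)` can be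
made true and bit `(k', n)` false. -/
theorem Cohen.eq_bot_of_inf_bit_le {K : Type} {k k' : K} (hk : k ≠ k') {b : Cohen (K × ℕ)}
    (h : ∀ n, b ⊓ bit (k, n) ≤ bit (k', n)) : b = ⊥ := by
  classical
  by_contra hb
  obtain ⟨x, hx⟩ := Cohen.exists_mem hb
  obtain ⟨F, hF⟩ := exists_cylinder_subset b.val.isOpen hx
  obtain ⟨n, hn⟩ := (F.image Prod.snd).exists_notMem
  have hn' : ∀ j, (j, n) ∉ F := fun j hj => hn (Finset.mem_image_of_mem Prod.snd hj)
  let y : K × ℕ → Bool := fun p => if p.2 = n then decide (p.1 = k) else x p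
  have hy : y ∈ b.val := hF fun p hp => by
    have : p.2 ≠ n := fun h => hn' p.1 (h ▸ hp)
    simp [y, this]
  have h1 : y ∈ (b ⊓ bit (k, n)).val := ⟨hy, Cohen.mem_bit.2 (by simp [y])⟩
  have h2 := Cohen.mem_bit.1 (Heyting.Regular.coe_le_coe.2 (h n) h1)
  simp [y, hk.symm] at h2

end Cohen

theorem not_proves_CH : ¬ Theory.Proves ZFC CH := by
  intro h
  obtain ⟨U, -⟩ := Ult.exists_of_ne_bot (B := Cohen (Set Omega1 × ℕ)) (a := ⊤) (by
    intro h
    have h1 : (fun _ => true) ∈ (⊤ : Cohen (Set Omega1 × ℕ)).val := trivial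
    rw [h] at h1
    exact h1)
  exact not_sat_CH (U := U) ccc_cohen (fun k n => Cohen.bit (k, n))
    (fun k k' hk b hb => Cohen.eq_bot_of_inf_bit_le hk hb) _ (sat_of_proves U (fun _ => empty) h)

end BooleanModel

namespace BooleanModel

open FOL SetTheory Name

/-! ### Collapsing the continuum without adding reals -/

section Collapse

variable {B : Type} [CompleteBooleanAlgebra B] {U : Ult B}

/-- The canonical name of a set of natural numbers. -/
noncomputable def Name.ground (r : Set ℕ) : Name B := mk r (fun n => ord n.1) fun _ => ⊤

/-- Countable distributivity: below some element of a partition, every term of a sequence is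
decided. -/
def CountablyDistributive (B : Type) [CompleteBooleanAlgebra B] : Prop :=
  ∀ a : ℕ → B, ⨆ r : Set ℕ, (⨅ n : r, a n) ⊓ (⨅ n : (rᶜ : Set ℕ), (a n)ᶜ) = ⊤

theorem ground_subset {r : Set ℕ} : cls U (ground r) ⊆ cls U (ordType ℕ) := by
  rw [Universe.subset_def, Universe.forall_iff]
  intro x hx
  rw [← holds_mem]
  refine holds_of_mem (Γ := ⊤) U.top hx fun n V _ _ hx => ?_
  rw [holds_mem, hx]
  exact ord_mem_ordType n.1

/-- A countably distributive algebra adds no reals. -/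
theorem sub_omega_le (hB : CountablyDistributive B) (y : Name B) :
    sub y (ordType ℕ) ≤ ⨆ r, eq y (ground r) := by
  -- Distributivity splits `⊤` into pieces on which every "`n ∈ y`" is decided; on the piece of `r`,
  -- `y` is `ground r`.
  rw [← inf_top_eq (sub y _), ← hB fun n => mem (ord n) y, inf_iSup_eq]
  refine iSup_mono fun r => Ult.le_iff.2 fun V hV => ?_
  rw [V.inf, holds_sub] at hV
  rw [holds_eq]
  refine Universe.ext (Universe.forall_iff.2 fun x => ⟨fun hx => ?_, fun hx => ?_⟩)
  · rw [← holds_mem]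
    refine holds_of_mem_ordType (V.inf.2 ⟨hV.2, holds_mem.2 hx⟩) (hV.1 _ hx) fun n V hV hx => ?_
    rw [V.inf, holds_mem, hx] at hV
    rw [holds_mem, hx]
    by_cases hn : n ∈ r
    · exact cls_el_mem (A := ground r) (i := (⟨n, hn⟩ : r)) V.top
    · exact absurd hV.2 (V.compl.1 (V.mono (inf_le_right.trans
        (iInf_le _ (⟨n, hn⟩ : (rᶜ : Set ℕ)))) hV.1))
  · rw [← holds_mem]
    refine holds_of_mem hV.2 hx fun (n : r) V hV _ hx => ?_
    rw [holds_mem, hx]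
    exact V.mono (inf_le_left.trans (iInf_le _ n)) hV

/-- All reals are ground reals, and `hg` makes each of them a value of the generic function.
Indexing by pairs gives the form required by `leq_of_family`. -/
theorem power_omega_eq (hB : CountablyDistributive B) {g : Omega1 → Set ℕ → B}
    (hg : ∀ r, ⨆ w, g w r = ⊤) : cls U (power (ordType ℕ)) =
      cls U (mk (Omega1 × Set ℕ) (fun p => ground p.2) fun p => g p.1 p.2) := by
  set X : Name B := mk (Omega1 × Set ℕ) (fun p => ground p.2) fun p => g p.1 p.2
  refine Universe.ext (Universe.forall_iff.2 fun y => ?_)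
  rw [mem_power, ← Universe.subset_def, ← holds_sub, ← holds_mem]
  refine ⟨fun h => U.mono ((sub_omega_le hB y).trans ?_) h, fun h => ?_⟩
  · refine iSup_le fun r => ?_
    rw [← inf_top_eq (eq y _), ← hg r, inf_iSup_eq]
    refine iSup_le fun w => ?_
    rw [inf_comm]
    exact le_iSup_of_le (f := fun p : Omega1 × Set ℕ => g p.1 p.2 ⊓ eq y (ground p.2)) (w, r) le_rfl
  · refine holds_of_mem (Γ := ⊤) U.top h fun (p : Omega1 × Set ℕ) V _ _ hy => ?_
    rw [holds_sub, hy]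
    exact ground_subset

/-- At a suitable `V` the set is `ord w`, and an injection of the predecessors of `w` into `ℕ`
transfers to names. -/
theorem leq_omega_of_mem_omega1 {x : Name B} (hx : cls U x ∈ cls U (ordType Omega1)) :
    Leq U x (ordType ℕ) := by
  have : Sat U (x ∷ fun _ => empty) (leqF &0 omegaT) := by
    refine holds_of_mem_ordType (Γ := ⊤) U.top hx fun w V _ hx => (?_ : Sat V _ _)
    simp only [sat_leqF, eval_var, scons_zero, eval_omegaT]
    obtain ⟨e, he⟩ := exists_injective_nat {v // v < w}
    refine leq_of_family (I := {v // v < w}) (s := fun i => ord (e i)) (x := fun i => ord i.1)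
      (b := fun _ => ⊤) (fun V i j _ _ h => ?_) ?_ (by rw [hx, ord_eq])
    · rw [he (ord_eq_ord_iff.1 h)]
    · rw [Universe.subset_def, Universe.forall_iff]
      intro y hy
      rw [← holds_mem]
      refine holds_of_mem (Γ := ⊤) V.top hy fun i V _ _ hy => ?_
      rw [holds_mem, hy]
      exact ord_mem_ordType _
  simpa using this

/-- If ω₁ is included in `x`, the generic function, read as pairs `(ord w, ground r)` of weight `g w
r`, maps part of `x` onto P(ω). Otherwise `x` is an element of ω₁. -/
theorem sat_CH_of_collapse (hB : CountablyDistributive B) {g : Omega1 → Set ℕ → B}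
    (hg : ∀ r, ⨆ w, g w r = ⊤) (hd : ∀ w r r', r ≠ r' → g w r ⊓ g w r' = ⊥) (v : ℕ → Name B) :
    Sat U v CH.1 := by
  rw [sat_CH]
  intro x hx
  rcases (isOrd_ordType (W := Omega1)).subset_or_mem hx with h | h
  · refine Or.inr (leq_of_family (s := fun p => ord p.1) (fun V p q hp hq h => ?_) ?_
      (power_omega_eq hB hg))
    · have h1 : p.1 = q.1 := ord_eq_ord_iff.1 h
      by_cases h2 : p.2 = q.2
      · rw [h2]
      · have h3 := hd p.1 _ _ h2
        rw [h1] at h3 hp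
        exact absurd (h3 ▸ V.inf.2 ⟨hp, hq⟩) V.bot
    · rw [Universe.subset_def, Universe.forall_iff]
      intro y hy
      refine h _ ?_
      rw [← holds_mem]
      refine holds_of_mem (Γ := ⊤) U.top hy fun p V _ _ hy => ?_
      rw [holds_mem, hy]
      exact ord_mem_ordType p.1
  · exact Or.inl (leq_omega_of_mem_omega1 h)

end Collapse

/-! ### The regular algebra of a preorder -/

section Forcing

variable {P : Type} [Preorder P]

/-- The complete Boolean algebra generated by a forcing notion. -/
def Forcing (P : Type) [Preorder P] : Type := Heyting.Regular (LowerSet P)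

namespace Forcing

noncomputable instance : CompleteBooleanAlgebra (Forcing P) :=
  inferInstanceAs (CompleteBooleanAlgebra (Heyting.Regular (LowerSet P)))

/-- The set of conditions below an element. -/
def conds (b : Forcing P) : LowerSet P := Heyting.Regular.val b

/-- The Boolean value of a condition. -/
def cond (p : P) : Forcing P := Heyting.Regular.toRegular (LowerSet.Iic p)

theorem mem_compl {s : LowerSet P} {p : P} : p ∈ sᶜ ↔ ∀ q ≤ p, q ∉ s := by
  rw [← LowerSet.Iic_le, le_compl_iff_disjoint_right, disjoint_iff]
  constructor
  · intro h q hq hs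
    have : q ∈ LowerSet.Iic p ⊓ s := ⟨hq, hs⟩
    rw [h] at this
    exact this
  · intro h
    refine le_bot_iff.1 fun q hq => ?_
    exact h q hq.1 hq.2

/-- The preorder need not be separative, so the regularization of `Iic p` may be larger than `Iic
p`. -/
theorem mem_cond {p q : P} : q ∈ (cond p).conds ↔ ∀ r ≤ q, ∃ s ≤ r, s ≤ p := by
  change q ∈ (LowerSet.Iic p)ᶜᶜ ↔ _
  rw [mem_compl]
  simp only [mem_compl, LowerSet.mem_Iic_iff]
  push Not
  rfl

theorem cond_le_iff {p : P} {b : Forcing P} : cond p ≤ b ↔ p ∈ b.conds := by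
  rw [← LowerSet.Iic_le]
  exact Heyting.Regular.gi.gc _ _

theorem cond_mono {p q : P} (h : q ≤ p) : cond q ≤ cond p :=
  Heyting.Regular.toRegular.monotone (LowerSet.Iic_le.2 h)

theorem exists_mem {b : Forcing P} (hb : b ≠ ⊥) : ∃ p, p ∈ b.conds := by
  by_contra! h
  exact hb (Heyting.Regular.coe_injective (le_bot_iff.1 fun p hp => h p hp))

theorem cond_ne_bot (p : P) : cond p ≠ ⊥ := by
  intro h
  have h1 := cond_le_iff.1 (le_refl (cond p))
  rw [h] at h1
  exact h1

theorem exists_le {p : P} {b : Forcing P} (h : cond p ⊓ b ≠ ⊥) : ∃ q ≤ p, cond q ≤ b := by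
  obtain ⟨r, hr⟩ := exists_mem h
  obtain ⟨s, hsr, hsp⟩ := mem_cond.1 hr.1 r le_rfl
  exact ⟨s, hsp, cond_le_iff.2 (b.conds.lower hsr hr.2)⟩

theorem iSup_eq_top {ι : Type*} {b : ι → Forcing P} (h : ∀ p, ∃ q ≤ p, ∃ i, cond q ≤ b i) :
    ⨆ i, b i = ⊤ := by
  by_contra hne
  obtain ⟨p, hp⟩ := exists_mem (compl_eq_bot.not.2 hne)
  obtain ⟨q, hq, i, hi⟩ := h p
  refine cond_ne_bot q (le_bot_iff.1 ?_)
  rw [← inf_compl_eq_bot (a := ⨆ i, b i)]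
  exact le_inf (hi.trans (le_iSup b i)) ((cond_mono hq).trans (cond_le_iff.2 hp))

/-- Countably closed forcing notions are countably distributive. -/
theorem countablyDistributive
    (hP : ∀ p : ℕ → P, (∀ n, p (n + 1) ≤ p n) → ∃ q, ∀ n, q ≤ p n) :
    CountablyDistributive (Forcing P) := by
  intro a
  refine iSup_eq_top fun p => ?_
  have step : ∀ (n : ℕ) (p : P), ∃ q ≤ p, cond q ≤ a n ∨ cond q ≤ (a n)ᶜ := by
    intro n p
    by_cases h : cond p ⊓ a n = ⊥
    · exact ⟨p, le_rfl, Or.inr (le_compl_iff_disjoint_right.2 (disjoint_iff.2 h))⟩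
    · obtain ⟨q, hq, h⟩ := exists_le h
      exact ⟨q, hq, Or.inl h⟩
  choose next hnext hdec using step
  obtain ⟨s, h0, hs⟩ : ∃ s : ℕ → P, s 0 = p ∧ ∀ n, s (n + 1) = next n (s n) :=
    ⟨fun n => Nat.rec p next n, rfl, fun _ => rfl⟩
  obtain ⟨q, hq⟩ := hP s fun n => hs n ▸ hnext n (s n)
  -- The condition `s (n + 1)` decides `a n`, so the lower bound `q` decides all terms at once.
  refine ⟨q, h0 ▸ hq 0, {n | cond (s (n + 1)) ≤ a n}, le_inf (le_iInf fun n => ?_) (le_iInf fun n => ?_)⟩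
  · exact (cond_mono (hq _)).trans n.2
  · have h := hdec n.1 (s n.1)
    rw [← hs] at h
    exact (cond_mono (hq _)).trans (h.resolve_left n.2)

end Forcing

end Forcing

/-! ### Countable partial functions -/

/-- Countable partial functions from `ω₁` to the power set of the natural numbers. -/
structure PartialReal where
  /-- The domain. -/
  dom : Set Omega1
  countable_dom : dom.Countable
  /-- The values, which are only relevant on the domain. -/
  toFun : Omega1 → Set ℕ

namespace PartialReal

instance : Preorder PartialReal where
  le p q := q.dom ⊆ p.dom ∧ ∀ w ∈ q.dom, p.toFun w = q.toFun w
  le_refl p := ⟨subset_rfl, fun _ _ => rfl⟩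
  le_trans p q r h h' := ⟨h'.1.trans h.1, fun w hw => (h.2 w (h'.1 hw)).trans (h'.2 w hw)⟩

theorem exists_lower_bound (p : ℕ → PartialReal) (hp : ∀ n, p (n + 1) ≤ p n) :
    ∃ q, ∀ n, q ≤ p n := by
  classical
  have hanti : Antitone p := antitone_nat_of_succ_le hp
  -- The lower bound is the union of the conditions. Any stage defined at `w` gives the same value
  -- by coherence; `∅` is an irrelevant default off the domain.
  refine ⟨⟨⋃ n, (p n).dom, Set.countable_iUnion fun n => (p n).countable_dom, fun w =>
    if h : ∃ n, w ∈ (p n).dom then (p h.choose).toFun w else ∅⟩, fun n =>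
    ⟨Set.subset_iUnion (fun n => (p n).dom) n, fun w hw => ?_⟩⟩
  have h : ∃ n, w ∈ (p n).dom := ⟨n, hw⟩
  simp only [dif_pos h]
  rcases le_total n h.choose with h' | h'
  · exact (hanti h').2 w hw
  · exact ((hanti h').2 w h.choose_spec).symm

/-- The Boolean value of the generic function taking the value `r` at `w`. -/
noncomputable def value (w : Omega1) (r : Set ℕ) : Forcing PartialReal :=
  ⨆ p : {p : PartialReal // w ∈ p.dom ∧ p.toFun w = r}, Forcing.cond p.1

/-- A density argument: a countable domain misses some `w`, where the value `r` can be added. Thus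
the generic function is onto the ground reals. -/
theorem iSup_value (r : Set ℕ) : ⨆ w, value w r = ⊤ := by
  classical
  refine Forcing.iSup_eq_top fun p => ?_
  obtain ⟨w, hw⟩ : ∃ w, w ∉ p.dom := by
    by_contra! h
    exact Set.not_countable_univ (α := Omega1) ((Set.eq_univ_of_forall h) ▸ p.countable_dom)
  let q : PartialReal := ⟨insert w p.dom, p.countable_dom.insert w, Function.update p.toFun w r⟩
  refine ⟨q, ⟨Set.subset_insert _ _, fun u hu => ?_⟩, w, ?_⟩
  · exact Function.update_of_ne (ne_of_mem_of_not_mem hu hw) _ _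
  · exact le_iSup (fun p : {p : PartialReal // w ∈ p.dom ∧ p.toFun w = r} => Forcing.cond p.1)
      ⟨q, Set.mem_insert _ _, Function.update_self _ _ _⟩

/-- If the meet were nonzero, two conditions with values `r` and `r'` at `w` would have a common
extension `t`, forcing the values to agree. -/
theorem value_inf_value {w : Omega1} {r r' : Set ℕ} (h : r ≠ r') : value w r ⊓ value w r' = ⊥ := by
  simp only [value, iSup_inf_eq, inf_iSup_eq, iSup_eq_bot]
  intro p q
  by_contra hne
  obtain ⟨s, hs, hs'⟩ := Forcing.exists_le hne
  obtain ⟨t, hts, ht⟩ := Forcing.mem_cond.1 (Forcing.cond_le_iff.1 hs') s le_rfl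
  rw [← p.2.2, ← q.2.2, ← ht.2 w p.2.1, ← (hts.trans hs).2 w q.2.1] at h
  exact h rfl

end PartialReal

theorem not_proves_not_CH : ¬ Theory.Proves ZFC (Sentence.not CH) := by
  intro h
  obtain ⟨U, -⟩ := Ult.exists_of_ne_bot
    (Forcing.cond_ne_bot (⟨∅, Set.countable_empty, fun _ => ∅⟩ : PartialReal))
  refine sat_neg.1 (sat_of_proves U (fun _ => empty) h) ?_
  exact sat_CH_of_collapse (Forcing.countablyDistributive PartialReal.exists_lower_bound)
    PartialReal.iSup_value (fun _ _ _ => PartialReal.value_inf_value) _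

end BooleanModel

theorem mainTheorem1 : FOL.Independent SetTheory.ZFC SetTheory.CH :=
  ⟨BooleanModel.not_proves_CH, BooleanModel.not_proves_not_CH⟩
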